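/- Let $\mathrm{VAR}$ be a countably infinite set of propositional variables. Formulas of propositional dependence logic (PDL) are generated by $$\varphi ::= \top \mid \bot \mid x \mid \lnot x \mid \varphi\lor\varphi \mid \varphi\land\varphi \mid \mathsf{dep}(P;Q) \mid \lnot\mathsf{dep}(P;Q),$$ with $x\in\mathrm{VAR}$ and $P,Q\subseteq\mathrm{VAR}$ finite. A team $T$ is a set of assignments to $\{0,1\}$, and: $T\models\top$ always; $T\models\bot$ never; $T\models x$ (resp. $T\models\lnot x$) iff $t(x)=1$ (resp. $t(x)=0$) for all $t\in T$; $T\models\varphi\land\psi$ iff $T\models\varphi$ and $T\models\psi$; $T\models\varphi\lor\psi$ iff $T=T_1\cup T_2$ for some $T_1\models\varphi$ and $T_2\models\psi$; $T\models\mathsf{dep}(P;Q)$ iff any two $t,t'\in T$ that agree on $P$ agree on $Q$; $T\models\lnot\mathsf{dep}(P;Q)$ iff $T=\emptyset$. The model checking problem MC asks, given a PDL-formula $\Phi$ and a finite team $T=\{s_1,\dots,s_m\}$ of pairwise distinct assignments on the variables of $\Phi$, whether $T\models\Phi$. To an instance $\langle T,\Phi\rangle$ associate the relational structure $\mathcal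 A_{T,\Phi}$ whose universe consists of the subformulas of $\Phi$ (a formula occurring several times is one element; the variables mentioned in a dependence atom count as its immediate subformulas) together with elements $c_1,\dots,c_m$ for the assignments $s_1,\dots,s_m$. Its relations are: the unary relations "is a subformula", "is a variable", "is a team element"; the immediate-subformula relation; the relations $(\lnot\alpha,\alpha)$, $(\alpha\land\beta,\alpha,\beta)$, $(\alpha\lor\beta,\alpha,\beta)$ and $(\mathsf{dep}(P;Q),p,q)$ with $p\in P$, $q\in Q$; and the relations $\mathrm{isTrue}$ and $\mathrm{isFalse}$ consisting of the pairs $(c_i,x)$, $x$ a variable of $\Phi$, with $s_i(x)=1$ and $s_i(x)=0$, respectively. In its Gaifman graph two distinct elements are adjacent iff they share a tuple of some relation. Let $\mathrm{tw}(T,\Phi)$ be the treewidth of this graph. **Claim.** MC parameterised by $\mathrm{tw}(T,\Phi)$ is fixed-parameter tractable: there are a deterministic (multi-tape) Turing machine, a computable function $f\colon\mathbb N\to\mathbb N$ and a constant $c$ such that on every instance $\langle T,\Phi\rangle$, written as a word $w$ over a fixed finite alphabet (formula in prefix notation, variable names in binary, assignments as lists of value–variable pairs), the machine halts after at most $f(\mathrm{tw}(T,\Phi))\cdot(|w|+1)^{c}$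 steps and answers correctly whether $T\models\Phi$. -/

import Mathlib

namespace PDLogic

/-! ### Syntax and team semantics of propositional dependence logic -/

/-- Formulas of propositional dependence logic; the countably many propositional variables are
named by natural numbers. Negation is atomic. -/
inductive Formula : Type
  | top : Formula
  | bot : Formula
  | var : ℕ → Formula
  | negVar : ℕ → Formula
  | or : Formula → Formula → Formula
  | and : Formula → Formula → Formula
  | dep : Finset ℕ → Finset ℕ → Formula
  | negDep : Finset ℕ → Finset ℕ → Formula
  deriving DecidableEq

namespace Formula

/-- Team semantics (with lax split-junction). A team is a set of assignments. -/
def Sat : Formula → Set (ℕ → Bool) → Prop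
  | top, _ => True
  | bot, _ => False
  | var x, T => ∀ t ∈ T, t x = true
  | negVar x, T => ∀ t ∈ T, t x = false
  | or φ ψ, T => ∃ T₁ T₂ : Set (ℕ → Bool), T₁ ∪ T₂ = T ∧ φ.Sat T₁ ∧ ψ.Sat T₂
  | and φ ψ, T => φ.Sat T ∧ ψ.Sat T
  | dep P Q, T => ∀ t ∈ T, ∀ t' ∈ T, (∀ p ∈ P, t p = t' p) → ∀ q ∈ Q, t q = t' q
  | negDep _ _, T => T = ∅

/-- The set of propositional variables of a formula. -/
def vars : Formula → Finset ℕ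
  | top => ∅
  | bot => ∅
  | var x => {x}
  | negVar x => {x}
  | or φ ψ => φ.vars ∪ ψ.vars
  | and φ ψ => φ.vars ∪ ψ.vars
  | dep P Q => P ∪ Q
  | negDep P Q => P ∪ Q

/-- The immediate subformulas, i.e. the children of the gate of the formula in the syntax circuit.
The children of a dependence atom are the variables it mentions. -/
def immediate : Formula → Finset Formula
  | top => ∅
  | bot => ∅
  | var _ => ∅
  | negVar x => {var x}
  | or φ ψ => {φ, ψ}
  | and φ ψ => {φ, ψ}
  | dep P Q => (P ∪ Q).image var
  | negDep P Q => {dep P Q}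

/-- The set of subformulas, i.e. the gates of the syntax circuit. -/
def subformulas : Formula → Finset Formula
  | top => {top}
  | bot => {bot}
  | var x => {var x}
  | negVar x => {negVar x, var x}
  | or φ ψ => insert (or φ ψ) (φ.subformulas ∪ ψ.subformulas)
  | and φ ψ => insert (and φ ψ) (φ.subformulas ∪ ψ.subformulas)
  | dep P Q => insert (dep P Q) ((P ∪ Q).image var)
  | negDep P Q => insert (negDep P Q) (insert (dep P Q) ((P ∪ Q).image var))

theorem self_mem_subformulas (φ : Formula) : φ ∈ φ.subformulas := by
  cases φ <;> simp [subformulas]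

/-- Every variable of a formula is a gate of its syntax circuit, and conversely. -/
theorem var_mem_subformulas_iff (φ : Formula) (x : ℕ) : var x ∈ φ.subformulas ↔ x ∈ φ.vars := by
  induction φ <;> simp_all [subformulas, vars]

end Formula

/-! ### Instances of the model checking problem -/

/-- An instance `⟨T, Φ⟩` of model checking: a formula and a team `T = {s₁, …, sₘ}`, listed as
pairwise distinct assignments of truth values to the variables of the formula. -/
structure MCInstance where
  formula : Formula
  team : List ({x // x ∈ formula.vars} → Bool)
  nodup : team.Nodup

namespace MCInstance

/-- View an assignment on a finite set `V` of variables as an assignment on all variables. The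
values outside `V` are irrelevant for formulas with variables in `V`. -/
def extend {V : Finset ℕ} (s : {x // x ∈ V} → Bool) (x : ℕ) : Bool :=
  if h : x ∈ V then s ⟨x, h⟩ else false

/-- The question of the model checking problem: `T ⊨ Φ`. -/
def Holds (I : MCInstance) : Prop :=
  I.formula.Sat {t | ∃ s ∈ I.team, extend s = t}

end MCInstance

/-! ### The structure of an instance and its Gaifman graph -/

/-- The constant symbols `r, c₁, …, cₘ`. -/
inductive MCFunc (m : ℕ) : ℕ → Type
  | root : MCFunc m 0
  | member : Fin m → MCFunc m 0

/-- The relation symbols of the vocabulary, indexed by their arity. -/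
inductive MCRel : ℕ → Type
  | isSubformula : MCRel 1
  | succ : MCRel 2
  | isVar : MCRel 1
  | neg : MCRel 2
  | conj : MCRel 3
  | disj : MCRel 3
  | dep : MCRel 3
  | inTeam : MCRel 1
  | isTrue : MCRel 2
  | isFalse : MCRel 2

/-- The vocabulary of the structures encoding instances with a team of size `m`. -/
def mcLanguage (m : ℕ) : FirstOrder.Language := ⟨MCFunc m, MCRel⟩

namespace MCInstance

/-- The universe: the subformulas of `Φ` together with one element per assignment of the team. -/
abbrev Universe (I : MCInstance) : Type :=
  {φ // φ ∈ I.formula.subformulas} ⊕ Fin I.team.length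

/-- The relation "`c` is a team element, `φ` is a variable, and the assignment of `c` maps it
to `b`". -/
def Assigns (I : MCInstance) (b : Bool) (c φ : I.Universe) : Prop :=
  ∃ (i : Fin I.team.length) (ψ : {ψ // ψ ∈ I.formula.subformulas}) (x : ℕ)
    (hx : x ∈ I.formula.vars),
    c = .inr i ∧ φ = .inl ψ ∧ ψ.1 = .var x ∧ I.team.get i ⟨x, hx⟩ = b

/-- The interpretation of the relation symbols. -/
def interpret (I : MCInstance) : {n : ℕ} → MCRel n → (Fin n → I.Universe) → Prop
  | _, .isSubformula, t => ∃ φ, t 0 = .inl φ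
  | _, .succ, t => ∃ φ ψ, t 0 = .inl φ ∧ t 1 = .inl ψ ∧ ψ.1 ∈ φ.1.immediate
  | _, .isVar, t => ∃ φ, t 0 = .inl φ ∧ ∃ x, φ.1 = .var x
  | _, .neg, t => ∃ φ ψ, t 0 = .inl φ ∧ t 1 = .inl ψ ∧
      ((∃ x, φ.1 = .negVar x ∧ ψ.1 = .var x) ∨ ∃ P Q, φ.1 = .negDep P Q ∧ ψ.1 = .dep P Q)
  | _, .conj, t => ∃ φ ψ χ, t 0 = .inl φ ∧ t 1 = .inl ψ ∧ t 2 = .inl χ ∧ φ.1 = .and ψ.1 χ.1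
  | _, .disj, t => ∃ φ ψ χ, t 0 = .inl φ ∧ t 1 = .inl ψ ∧ t 2 = .inl χ ∧ φ.1 = .or ψ.1 χ.1
  | _, .dep, t => ∃ φ ψ χ, t 0 = .inl φ ∧ t 1 = .inl ψ ∧ t 2 = .inl χ ∧
      ∃ P Q, φ.1 = .dep P Q ∧ (∃ p ∈ P, ψ.1 = .var p) ∧ ∃ q ∈ Q, χ.1 = .var q
  | _, .inTeam, t => ∃ i, t 0 = .inr i
  | _, .isTrue, t => I.Assigns true (t 0) (t 1)
  | _, .isFalse, t => I.Assigns false (t 0) (t 1)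

/-- The structure encoding the syntax circuit of `Φ` and the team `T`. -/
instance instStructure (I : MCInstance) : (mcLanguage I.team.length).Structure I.Universe where
  funMap f _ := match f with
    | MCFunc.root => .inl ⟨I.formula, I.formula.self_mem_subformulas⟩
    | MCFunc.member i => .inr i
  RelMap R t := I.interpret R t

end MCInstance

/-- The Gaifman graph of a relational structure: distinct elements are adjacent iff they share a
tuple of some relation. -/
def gaifmanGraph (L : FirstOrder.Language) (A : Type*) [L.Structure A] : SimpleGraph A where
  Adj u v := u ≠ v ∧ ∃ (n : ℕ) (R : L.Relations n) (t : Fin n → A),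
    FirstOrder.Language.Structure.RelMap R t ∧ u ∈ Set.range t ∧ v ∈ Set.range t
  symm := ⟨fun _ _ ⟨h, n, R, t, hR, hu, hv⟩ => ⟨h.symm, n, R, t, hR, hv, hu⟩⟩
  loopless := ⟨fun _ h => h.1 rfl⟩

/-! ### Treewidth -/

/-- A tree decomposition of a graph: a tree whose nodes are bags of vertices. -/
structure TreeDecomposition {V : Type*} (G : SimpleGraph V) where
  bags : Finset (Finset V)
  tree : SimpleGraph {b // b ∈ bags}
  isTree : tree.IsTree
  cover : ∀ v : V, ∃ b ∈ bags, v ∈ b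
  edge : ∀ u v : V, G.Adj u v → ∃ b ∈ bags, u ∈ b ∧ v ∈ b
  connected : ∀ v : V, (tree.induce {b | v ∈ b.1}).Connected

/-- The width: the size of the largest bag minus one. -/
def TreeDecomposition.width {V : Type*} {G : SimpleGraph V} (D : TreeDecomposition G) : ℕ :=
  D.bags.sup Finset.card - 1

/-- The treewidth: the least width of a tree decomposition. -/
noncomputable def treewidth {V : Type*} (G : SimpleGraph V) : ℕ :=
  sInf {w | ∃ D : TreeDecomposition G, D.width = w}

/-- A finite graph has a tree decomposition (with a single bag), so the minimum in the definition
of treewidth is over a nonempty set. -/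
theorem TreeDecomposition.nonempty {V : Type*} [Fintype V] (G : SimpleGraph V) :
    Nonempty (TreeDecomposition G) := by
  have hT : (⊥ : SimpleGraph {b // b ∈ ({Finset.univ} : Finset (Finset V))}).IsTree :=
    SimpleGraph.IsTree.of_subsingleton
  refine ⟨⟨{Finset.univ}, ⊥, hT, by simp, by simp, fun v => ?_⟩⟩
  have : Nonempty ({b : {b // b ∈ ({Finset.univ} : Finset (Finset V))} | v ∈ b.1} : Set _) :=
    ⟨⟨⟨Finset.univ, by simp⟩, by simp⟩⟩
  exact SimpleGraph.Connected.of_subsingleton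

/-- The treewidth of the Gaifman graph of the structure encoding formula circuit and team. -/
noncomputable def MCInstance.formulaTeamTreewidth (I : MCInstance) : ℕ :=
  treewidth (gaifmanGraph (mcLanguage I.team.length) I.Universe)

/-! ### Encoding of instances as words -/

/-- The alphabet used to write down instances. -/
inductive Symbol : Type
  | top | bot | var | negVar | or | and | dep | negDep
  | digit (b : Bool)
  | endNumber | endSet | endFormula
  | value (b : Bool)
  | endRow
  deriving DecidableEq, Fintype

/-- A variable is written as its index in binary, followed by an end marker. -/
def encodeVar (x : ℕ) : List Symbol :=
  (Computability.encodeNat x).map Symbol.digit ++ [Symbol.endNumber]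

/-- A finite set of variables is written as the list of its elements, with an end marker. -/
def encodeVarSet (X : Finset ℕ) : List Symbol :=
  ((X.sort (· ≤ ·)).flatMap encodeVar) ++ [Symbol.endSet]

/-- Formulas are written in prefix notation. -/
def Formula.encode : Formula → List Symbol
  | .top => [.top]
  | .bot => [.bot]
  | .var x => .var :: encodeVar x
  | .negVar x => .negVar :: encodeVar x
  | .or φ ψ => .or :: (φ.encode ++ ψ.encode)
  | .and φ ψ => .and :: (φ.encode ++ ψ.encode)
  | .dep P Q => .dep :: (encodeVarSet P ++ encodeVarSet Q)
  | .negDep P Q => .negDep :: (encodeVarSet P ++ encodeVarSet Q)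

/-- An assignment is written as the list of the pairs (value of `x`, `x`), where `x` runs through
its domain in increasing order, with an end marker. -/
def encodeAssignment {V : Finset ℕ} (s : {x // x ∈ V} → Bool) : List Symbol :=
  ((V.sort (· ≤ ·)).flatMap fun x => Symbol.value (MCInstance.extend s x) :: encodeVar x) ++
    [Symbol.endRow]

/-- An instance is written as its formula, followed by the rows of its team. -/
def MCInstance.encode (I : MCInstance) : List Symbol :=
  I.formula.encode ++ Symbol.endFormula :: I.team.flatMap encodeAssignment

theorem encodeVar_append_inj {x y : ℕ} {s t : List Symbol}
    (h : encodeVar x ++ s = encodeVar y ++ t) : x = y ∧ s = t := by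
  have key : ∀ (a b : List Bool), a.map Symbol.digit ++ ([Symbol.endNumber] ++ s) =
      b.map Symbol.digit ++ ([Symbol.endNumber] ++ t) → a = b ∧ s = t := by
    intro a
    induction a with
    | nil => intro b; cases b <;> simp
    | cons c a ih =>
      intro b
      cases b with
      | nil => simp
      | cons d b =>
        intro h
        simp only [List.map_cons, List.cons_append, List.cons.injEq, Symbol.digit.injEq] at h
        obtain ⟨h₁, h₂⟩ := ih b h.2
        exact ⟨by rw [h.1, h₁], h₂⟩
  simp only [encodeVar, List.append_assoc] at h
  obtain ⟨h₁, h₂⟩ := key _ _ h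
  refine ⟨?_, h₂⟩
  rw [← Computability.decode_encodeNat x, h₁, Computability.decode_encodeNat]

theorem encodeVarSet_append_inj {X Y : Finset ℕ} {s t : List Symbol}
    (h : encodeVarSet X ++ s = encodeVarSet Y ++ t) : X = Y ∧ s = t := by
  have ne : ∀ x (u v : List Symbol), encodeVar x ++ u ≠ Symbol.endSet :: v := by
    intro x u v
    unfold encodeVar
    cases Computability.encodeNat x <;> simp
  have key : ∀ (a b : List ℕ), a.flatMap encodeVar ++ ([Symbol.endSet] ++ s) =
      b.flatMap encodeVar ++ ([Symbol.endSet] ++ t) → a = b ∧ s = t := by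
    intro a
    induction a with
    | nil =>
      intro b
      cases b with
      | nil => simp
      | cons d b =>
        intro h
        simp only [List.flatMap_nil, List.nil_append, List.flatMap_cons, List.append_assoc,
          List.cons_append] at h
        exact absurd h.symm (ne _ _ _)
    | cons c a ih =>
      intro b
      cases b with
      | nil =>
        intro h
        simp only [List.flatMap_nil, List.nil_append, List.flatMap_cons, List.append_assoc,
          List.cons_append] at h
        exact absurd h (ne _ _ _)
      | cons d b =>
        intro h
        simp only [List.flatMap_cons, List.append_assoc] at h
        obtain ⟨h₁, h₂⟩ := encodeVar_append_inj h
        obtain ⟨h₃, h₄⟩ := ih b (by simpa using h₂)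
        exact ⟨by rw [h₁, h₃], h₄⟩
  simp only [encodeVarSet, List.append_assoc] at h
  obtain ⟨h₁, h₂⟩ := key _ _ h
  refine ⟨?_, h₂⟩
  rw [← Finset.sort_toFinset X (· ≤ ·), h₁, Finset.sort_toFinset]

theorem Formula.encode_append_inj {φ ψ : Formula} {s t : List Symbol}
    (h : φ.encode ++ s = ψ.encode ++ t) : φ = ψ ∧ s = t := by
  induction φ generalizing ψ s t with
  | top => cases ψ <;> simp_all [Formula.encode]
  | bot => cases ψ <;> simp_all [Formula.encode]
  | var x =>
    cases ψ <;> simp [Formula.encode] at h ⊢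
    exact encodeVar_append_inj h
  | negVar x =>
    cases ψ <;> simp [Formula.encode] at h ⊢
    exact encodeVar_append_inj h
  | or φ₁ φ₂ ih₁ ih₂ =>
    cases ψ <;> simp [Formula.encode] at h ⊢
    obtain ⟨h₁, h₂⟩ := ih₁ h
    obtain ⟨h₃, h₄⟩ := ih₂ h₂
    exact ⟨⟨h₁, h₃⟩, h₄⟩
  | and φ₁ φ₂ ih₁ ih₂ =>
    cases ψ <;> simp [Formula.encode] at h ⊢
    obtain ⟨h₁, h₂⟩ := ih₁ h
    obtain ⟨h₃, h₄⟩ := ih₂ h₂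
    exact ⟨⟨h₁, h₃⟩, h₄⟩
  | dep P Q =>
    cases ψ <;> simp [Formula.encode] at h ⊢
    obtain ⟨h₁, h₂⟩ := encodeVarSet_append_inj h
    obtain ⟨h₃, h₄⟩ := encodeVarSet_append_inj h₂
    exact ⟨⟨h₁, h₃⟩, h₄⟩
  | negDep P Q =>
    cases ψ <;> simp [Formula.encode] at h ⊢
    obtain ⟨h₁, h₂⟩ := encodeVarSet_append_inj h
    obtain ⟨h₃, h₄⟩ := encodeVarSet_append_inj h₂
    exact ⟨⟨h₁, h₃⟩, h₄⟩

theorem encodeAssignment_append_inj {V : Finset ℕ} {a b : {x // x ∈ V} → Bool}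
    {s t : List Symbol} (h : encodeAssignment a ++ s = encodeAssignment b ++ t) :
    a = b ∧ s = t := by
  have key : ∀ l : List ℕ,
      (l.flatMap fun x => Symbol.value (MCInstance.extend a x) :: encodeVar x) ++
        ([Symbol.endRow] ++ s) =
      (l.flatMap fun x => Symbol.value (MCInstance.extend b x) :: encodeVar x) ++
        ([Symbol.endRow] ++ t) →
      (∀ x ∈ l, MCInstance.extend a x = MCInstance.extend b x) ∧ s = t := by
    intro l
    induction l with
    | nil => simp
    | cons c l ih =>
      intro h
      simp only [List.flatMap_cons, List.append_assoc, List.cons_append, List.cons.injEq,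
        Symbol.value.injEq] at h
      obtain ⟨h₁, h₂⟩ := ih (by simpa using (encodeVar_append_inj h.2).2)
      exact ⟨by simpa using ⟨h.1, h₁⟩, h₂⟩
  simp only [encodeAssignment, List.append_assoc] at h
  obtain ⟨h₁, h₂⟩ := key _ h
  refine ⟨?_, h₂⟩
  funext x
  have := h₁ x.1 (by simp)
  simpa [MCInstance.extend, x.2] using this

/-- Distinct instances are encoded by distinct words. -/
theorem MCInstance.encode_injective : Function.Injective MCInstance.encode := by
  rintro ⟨φ, S, hS⟩ ⟨ψ, T, hT⟩ h
  obtain ⟨h₁, h₂⟩ := Formula.encode_append_inj h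
  subst h₁
  have key : ∀ A B : List ({x // x ∈ φ.vars} → Bool),
      A.flatMap encodeAssignment = B.flatMap encodeAssignment → A = B := by
    intro A
    induction A with
    | nil => intro B; cases B <;> simp [encodeAssignment]
    | cons a A ih =>
      intro B
      cases B with
      | nil => simp [encodeAssignment]
      | cons b B =>
        intro h
        simp only [List.flatMap_cons] at h
        obtain ⟨h₁, h₂⟩ := encodeAssignment_append_inj h
        rw [h₁, ih B h₂]
  have := key S T (by simpa using h₂)
  subst this
  rfl

/-! ### Fixed-parameter tractability -/

open Classical in
/-- A decision problem on instances of type `α`, written as words by `enc`, is fixed-parameter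
tractable with respect to the parameter `κ` if some deterministic multi-stack Turing machine
decides it on every instance `a` in at most `f (κ a) * (|a| + 1) ^ c` steps, where `f` is a
computable function and `c` a constant. The machine is given the instance only. -/
def IsFPT {α Γ : Type} [Fintype Γ] (enc : α → List Γ) (yes : α → Prop) (κ : α → ℕ) : Prop :=
  ∃ (M : Turing.TM2ComputableAux Γ Bool) (f : ℕ → ℕ) (c : ℕ),
    (∀ k, Finite (M.tm.Γ k)) ∧ Computable f ∧
    ∀ a : α, Nonempty (Turing.TM2OutputsInTime M.tm
      ((enc a).map M.inputAlphabet.symm)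
      (some ((Computability.encodeBool (decide (yes a))).map M.outputAlphabet.symm))
      (f (κ a) * ((enc a).length + 1) ^ c))

end PDLogic

/-! The parameter bounds the size of the team, after which brute force over all subteams is good
enough; neither a tree decomposition nor the value of the treewidth is ever computed by the machine.

Bounding the team: an assignment of the team gives every variable of the formula one of the two
truth values, so each team element shares an `isTrue` or `isFalse` tuple with each variable. The
Gaifman graph thus contains a complete bipartite graph between the m team elements and the v
variables. In a tree decomposition the subtrees belonging to one side all meet the subtrees
belonging to the other; by a bipartite form of the Helly property of subtrees
(`SimpleGraph.IsTree.exists_forall_mem_or`), one whole side lies in a single bag. So m ≤ tw + 1 or v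
≤ tw + 1, and in the second case m ≤ 2 ^ v because the assignments are distinct. Either way m ≤ 2 ^
(tw + 1), which is `MCInstance.length_team_le`.

The algorithm: for each subformula, compute the table of all subteams satisfying it. The formula is
in prefix notation and the team stands at the end of the word, so one pass from right to left first
collects the rows, then lists all subteams, and then evaluates the formula with a stack of tables
(`runWord_formula`, `val_programE`). Satisfaction is inherited by subteams (`sat_mono`), so for a
disjunction it is enough that a team is covered by one member of each table (`isTable_or`). A table
has size O(2 ^ m * n) and at most n of them are stacked, n being the length of the word.

The machine: the algorithm is a term of a small functional language whose only data are binary trees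
and whose only recursion is a fold over a list. Terms are compiled to programs on five stacks
holding trees in prefix code. If all intermediate values have size at most N, the compiled program
runs in time polynomial in N (`Expr.leads_compile`, `Expr.time_le`), since a fold makes fewer than N
iterations. The sizes are bounded by an invariant of the pass (`bdd_programE`), with N = O(2 ^ m * n
^ 2). Inserting the bound on m yields a doubly exponential function of the treewidth times a
polynomial in the length of the word. -/

/-! ### Structured stack programs -/

namespace StackProgram

open PDLogic Turing Function

/-- The symbols on the working stacks. -/
inductive Tok : Type
  | mark
  | cons
  | leaf (a : Option Symbol)
  deriving DecidableEq, Fintype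

/-- The working stacks. -/
inductive Reg : Type
  | env | main | b | c | cnt
  deriving DecidableEq

instance : Fintype Reg :=
  ⟨{.env, .main, .b, .c, .cnt}, fun r => by cases r <;> simp⟩

/-- All stacks: the working stacks, the input stack and the output stack. -/
inductive Stack : Type
  | inp | out
  | reg (r : Reg)
  deriving DecidableEq, Fintype

/-- The stack alphabets. -/
abbrev Alphabet : Stack → Type
  | .inp => Symbol
  | .out => Bool
  | .reg _ => Tok

/-- The contents of the working stacks. -/
abbrev Store := Reg → List Tok

/-- The finite control: the last token read, and a flag. -/
abbrev Control := Option Tok × Bool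

/-- The contents of all stacks. -/
def assemble (I : List Symbol) (O : List Bool) (S : Store) : ∀ k, List (Alphabet k)
  | .inp => I
  | .out => O
  | .reg r => S r

theorem update_assemble_reg (I : List Symbol) (O : List Bool) (S : Store) (r : Reg)
    (l : List Tok) :
    update (assemble I O S) (.reg r) l = assemble I O (update S r l) := by
  funext k
  rcases k with _ | _ | r'
  · exact update_of_ne (by simp) _ _
  · exact update_of_ne (by simp) _ _
  · by_cases h : r' = r
    · subst h
      exact (update_self _ _ _).trans (update_self r' l S).symm
    · exact (update_of_ne (by simpa using h) _ _).trans
        (update_of_ne (β := fun _ => List Tok) h l S).symm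

/-- Structured programs on the working stacks. -/
inductive Cmd : Type
  | push (D : List Reg) (f : Control → Tok)
  | pop (r : Reg) (f : Control → Option Tok → Control)
  | peek (r : Reg) (f : Control → Option Tok → Control)
  | load (f : Control → Control)
  | seq (p q : Cmd)
  | ite (t : Control → Bool) (p q : Cmd)
  | loop (t : Control → Bool) (p : Cmd)

infixr:60 " ;; " => Cmd.seq

namespace Cmd

/-- The labels of the machine code of a program. -/
def Label : Cmd → Type
  | push _ _ | pop _ _ | peek _ _ | load _ => Unit
  | seq p q => p.Label ⊕ q.Label
  | ite _ p q => Option (p.Label ⊕ q.Label)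
  | loop _ p => Option p.Label

/-- A program has finitely many labels. -/
@[reducible]
def labelFintype : (p : Cmd) → Fintype p.Label
  | push _ _ | pop _ _ | peek _ _ | load _ => inferInstanceAs (Fintype Unit)
  | seq p q =>
    letI := p.labelFintype; letI := q.labelFintype
    inferInstanceAs (Fintype (p.Label ⊕ q.Label))
  | ite _ p q =>
    letI := p.labelFintype; letI := q.labelFintype
    inferInstanceAs (Fintype (Option (p.Label ⊕ q.Label)))
  | loop _ p => letI := p.labelFintype; inferInstanceAs (Fintype (Option p.Label))

/-- The label at which a program starts. -/
def entry : (p : Cmd) → p.Label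
  | push _ _ | pop _ _ | peek _ _ | load _ => ()
  | seq p _ => Sum.inl p.entry
  | ite _ _ _ => (none : Option _)
  | loop _ _ => (none : Option _)

/-- The machine code of a program, whose labels are embedded by `ι` and which is left to `x`. -/
def code {Λ : Type} : (p : Cmd) → (p.Label → Λ) → Λ → p.Label → TM2.Stmt Alphabet Λ Control
  | push D f, _, x, _ => D.foldr (fun r q => .push (.reg r) f q) (.goto fun _ => x)
  | pop r f, _, x, _ => .pop (.reg r) f (.goto fun _ => x)
  | peek r f, _, x, _ => .peek (.reg r) f (.goto fun _ => x)
  | load f, _, x, _ => .load f (.goto fun _ => x)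
  | seq p q, ι, x, l =>
    Sum.elim (p.code (fun l => ι (Sum.inl l)) (ι (Sum.inr q.entry)))
      (q.code (fun l => ι (Sum.inr l)) x) l
  | ite t p q, ι, x, l =>
    Option.elim l
      (.branch t (.goto fun _ => ι (some (Sum.inl p.entry)))
        (.goto fun _ => ι (some (Sum.inr q.entry))))
      (Sum.elim (p.code (fun l => ι (some (Sum.inl l))) x)
        (q.code (fun l => ι (some (Sum.inr l))) x))
  | loop t p, ι, x, l =>
    Option.elim l
      (.branch t (.goto fun _ => ι (some p.entry)) (.goto fun _ => x))
      (p.code (fun l => ι (some l)) (ι none))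

end Cmd

/-! ### Timed execution of programs. -/

/-- A machine reaches a configuration from another one in at most `t` steps. -/
def ReachIn {Λ : Type} (M : Λ → TM2.Stmt Alphabet Λ Control)
    (a b : TM2.Cfg Alphabet Λ Control) (t : ℕ) : Prop :=
  ∃ n ≤ t, (flip bind (TM2.step M))^[n] (some a) = some b

theorem ReachIn.trans {Λ : Type} {M : Λ → TM2.Stmt Alphabet Λ Control}
    {a b c : TM2.Cfg Alphabet Λ Control} {t u : ℕ} (h : ReachIn M a b t) (h' : ReachIn M b c u) :
    ReachIn M a c (t + u) := by
  obtain ⟨n, hn, h⟩ := h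
  obtain ⟨n', hn', h'⟩ := h'
  refine ⟨n' + n, by omega, ?_⟩
  rw [iterate_add_apply, h, h']

theorem ReachIn.single {Λ : Type} {M : Λ → TM2.Stmt Alphabet Λ Control} {l : Λ} {v : Control}
    {S : ∀ k, List (Alphabet k)} {b : TM2.Cfg Alphabet Λ Control}
    (h : TM2.stepAux (M l) v S = b) : ReachIn M ⟨some l, v, S⟩ b 1 :=
  ⟨1, le_rfl, by simp [flip, h]⟩

theorem ReachIn.mono {Λ : Type} {M : Λ → TM2.Stmt Alphabet Λ Control}
    {a b : TM2.Cfg Alphabet Λ Control} {t u : ℕ} (h : ReachIn M a b t) (htu : t ≤ u) :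
    ReachIn M a b u := by
  obtain ⟨n, hn, h⟩ := h
  exact ⟨n, hn.trans htu, h⟩

/-- A program leads from a control state and store to another one in at most `t` steps. -/
def Runs (p : Cmd) (v : Control) (S : Store) (v' : Control) (S' : Store) (t : ℕ) : Prop :=
  ∀ ⦃Λ : Type⦄ (M : Λ → TM2.Stmt Alphabet Λ Control) (ι : p.Label → Λ) (x : Λ),
    (∀ l, M (ι l) = p.code ι x l) → ∀ I O,
      ReachIn M ⟨some (ι p.entry), v, assemble I O S⟩ ⟨some x, v', assemble I O S'⟩ t

/-- The store after pushing a token on several stacks. -/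
def pushAll (S : Store) (D : List Reg) (a : Tok) : Store :=
  D.foldl (fun S r => update S r (a :: S r)) S

theorem Runs.mono {p : Cmd} {v v' : Control} {S S' : Store} {t u : ℕ} (h : Runs p v S v' S' t)
    (htu : t ≤ u) : Runs p v S v' S' u :=
  fun _ M ι x hM I O => (h M ι x hM I O).mono htu

theorem stepAux_foldr_push {Λ : Type} (D : List Reg) (f : Control → Tok) (v : Control) (S : Store)
    (x : Λ) (I : List Symbol) (O : List Bool) :
    TM2.stepAux (Γ := Alphabet) (D.foldr (fun r q => .push (.reg r) f q) (.goto fun _ => x)) v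
      (assemble I O S) = ⟨some x, v, assemble I O (pushAll S D (f v))⟩ := by
  induction D generalizing S with
  | nil => rfl
  | cons r D ih =>
    have := ih (update S r (f v :: S r))
    rw [← update_assemble_reg] at this
    exact this

theorem Runs.push (D : List Reg) (f : Control → Tok) (v : Control) (S : Store) :
    Runs (.push D f) v S v (pushAll S D (f v)) 1 := by
  intro Λ M ι x hM I O
  refine ReachIn.single ?_
  rw [hM]
  exact stepAux_foldr_push D f v S x I O

theorem Runs.pop (r : Reg) (f : Control → Option Tok → Control) (v : Control) (S : Store) :
    Runs (.pop r f) v S (f v (S r).head?) (update S r (S r).tail) 1 := by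
  intro Λ M ι x hM I O
  refine ReachIn.single ?_
  rw [hM, ← update_assemble_reg]
  rfl

theorem Runs.peek (r : Reg) (f : Control → Option Tok → Control) (v : Control) (S : Store) :
    Runs (.peek r f) v S (f v (S r).head?) S 1 := by
  intro Λ M ι x hM I O
  refine ReachIn.single ?_
  rw [hM]
  rfl

theorem Runs.load (f : Control → Control) (v : Control) (S : Store) :
    Runs (.load f) v S (f v) S 1 := by
  intro Λ M ι x hM I O
  refine ReachIn.single ?_
  rw [hM]
  rfl

/-- `Runs` speaks of all machines containing the code under some labelling, with an arbitrary exit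
label. Hence the first program can be run with the entry of the second as its exit, and both
executions take place in the same machine. -/
theorem Runs.seq {p q : Cmd} {v v' v'' : Control} {S S' S'' : Store} {t u : ℕ}
    (h : Runs p v S v' S' t) (h' : Runs q v' S' v'' S'' u) :
    Runs (p ;; q) v S v'' S'' (t + u) := by
  intro Λ M ι x hM I O
  exact (h M (fun l => ι (Sum.inl l)) (ι (Sum.inr q.entry)) (fun l => hM (Sum.inl l)) I O).trans
    (h' M (fun l => ι (Sum.inr l)) x (fun l => hM (Sum.inr l)) I O)

theorem Runs.ite_true {c : Control → Bool} {p q : Cmd} {v v' : Control} {S S' : Store} {t : ℕ}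
    (hc : c v = true) (h : Runs p v S v' S' t) : Runs (.ite c p q) v S v' S' (1 + t) := by
  intro Λ M ι x hM I O
  refine ReachIn.trans (ReachIn.single (b := ⟨some (ι (some (Sum.inl p.entry))), v, _⟩) ?_)
    (h M (fun l => ι (some (Sum.inl l))) x (fun l => hM (some (Sum.inl l))) I O)
  rw [hM]
  simp [Cmd.code, Cmd.entry, hc]

theorem Runs.ite_false {c : Control → Bool} {p q : Cmd} {v v' : Control} {S S' : Store} {t : ℕ}
    (hc : c v = false) (h : Runs q v S v' S' t) : Runs (.ite c p q) v S v' S' (1 + t) := by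
  intro Λ M ι x hM I O
  refine ReachIn.trans (ReachIn.single (b := ⟨some (ι (some (Sum.inr q.entry))), v, _⟩) ?_)
    (h M (fun l => ι (some (Sum.inr l))) x (fun l => hM (some (Sum.inr l))) I O)
  rw [hM]
  simp [Cmd.code, Cmd.entry, hc]

theorem Runs.loop_done {c : Control → Bool} {p : Cmd} {v : Control} {S : Store}
    (hc : c v = false) : Runs (.loop c p) v S v S 1 := by
  intro Λ M ι x hM I O
  refine ReachIn.single ?_
  rw [hM]
  simp [Cmd.code, Cmd.entry, hc]

theorem Runs.loop_step {c : Control → Bool} {p : Cmd} {v v' v'' : Control} {S S' S'' : Store}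
    {t u : ℕ} (hc : c v = true) (h : Runs p v S v' S' t) (h' : Runs (.loop c p) v' S' v'' S'' u) :
    Runs (.loop c p) v S v'' S'' (1 + t + u) := by
  intro Λ M ι x hM I O
  refine ReachIn.trans (ReachIn.trans
    (ReachIn.single (b := ⟨some (ι (some p.entry)), v, _⟩) ?_)
    (h M (fun l => ι (some l)) (ι none) (fun l => hM (some l)) I O)) (h' M ι x hM I O)
  rw [hM]
  simp [Cmd.code, Cmd.entry, hc]

/-! ### S-expressions and their prefix codes -/

/-- Binary trees with labelled leaves. -/
inductive SExp : Type
  | leaf (a : Option Symbol)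
  | cons (x y : SExp)
  deriving DecidableEq

namespace SExp

/-- The empty list, and the truth value "false". -/
abbrev nil : SExp := leaf none

/-- The prefix code of an S-expression. -/
def enc : SExp → List Tok
  | leaf a => [.leaf a]
  | cons x y => .cons :: (x.enc ++ y.enc)

/-- The length of the prefix code. -/
def size : SExp → ℕ
  | leaf _ => 1
  | cons x y => x.size + y.size + 1

theorem length_enc (x : SExp) : x.enc.length = x.size := by
  induction x with
  | leaf a => rfl
  | cons x y hx hy => simp [enc, size, hx, hy]

theorem one_le_size (x : SExp) : 1 ≤ x.size := by
  cases x <;> simp [size]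

theorem mark_notMem_enc (x : SExp) : Tok.mark ∉ x.enc := by
  induction x with
  | leaf a => simp [enc]
  | cons x y hx hy => simp [enc, hx, hy]

/-- A prefix code is self-delimiting: the end of a tree can be recognised without looking at what
follows. -/
theorem enc_append_inj {x y : SExp} {s t : List Tok} (h : x.enc ++ s = y.enc ++ t) :
    x = y ∧ s = t := by
  induction x generalizing y s t with
  | leaf a => cases y <;> simp_all [enc]
  | cons x x' hx hx' =>
    cases y with
    | leaf a => simp [enc] at h
    | cons y y' =>
      simp only [enc, List.cons_append, List.append_assoc, List.cons.injEq, true_and] at h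
      obtain ⟨h₁, h₂⟩ := hx h
      obtain ⟨h₃, h₄⟩ := hx' h₂
      exact ⟨by rw [h₁, h₃], h₄⟩

theorem enc_inj {x y : SExp} : x.enc = y.enc ↔ x = y :=
  ⟨fun h => (enc_append_inj (s := []) (t := []) (by rw [h])).1, fun h => by rw [h]⟩

end SExp

/-! ### Basic loops on the working stacks -/

/-- A store given by the contents of its stacks. -/
def store (e m b c n : List Tok) : Store
  | .env => e
  | .main => m
  | .b => b
  | .c => c
  | .cnt => n

section store
variable (e m b c n l : List Tok)

@[simp] theorem store_env : store e m b c n .env = e := rfl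
@[simp] theorem store_main : store e m b c n .main = m := rfl
@[simp] theorem store_b : store e m b c n .b = b := rfl
@[simp] theorem store_c : store e m b c n .c = c := rfl
@[simp] theorem store_cnt : store e m b c n .cnt = n := rfl
@[simp] theorem update_store_env : update (store e m b c n) .env l = store l m b c n := by
  funext r; cases r <;> simp
@[simp] theorem update_store_main : update (store e m b c n) .main l = store e l b c n := by
  funext r; cases r <;> simp
@[simp] theorem update_store_b : update (store e m b c n) .b l = store e m l c n := by
  funext r; cases r <;> simp
@[simp] theorem update_store_c : update (store e m b c n) .c l = store e m b l n := by
  funext r; cases r <;> simp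

end store

/-- The store after moving a list of tokens, one by one, from the top of a stack to the top of
other stacks. -/
def move (S : Store) (D : List Reg) (l : List Tok) : Store :=
  l.foldl (fun S a => pushAll S D a) S

theorem pushAll_apply_of_notMem (S : Store) {D : List Reg} (a : Tok) {r : Reg}
    (h : r ∉ D) : pushAll S D a r = S r := by
  induction D generalizing S with
  | nil => rfl
  | cons r' D ih =>
    simp only [List.mem_cons, not_or] at h
    exact (ih (update S r' (a :: S r')) h.2).trans (update_of_ne h.1 _ _)

theorem pushAll_update_of_notMem (S : Store) {D : List Reg} (a : Tok) {r : Reg}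
    (h : r ∉ D) (l : List Tok) : pushAll (update S r l) D a = update (pushAll S D a) r l := by
  induction D generalizing S with
  | nil => rfl
  | cons r' D ih =>
    simp only [List.mem_cons, not_or] at h
    have := ih (update S r' (a :: S r')) h.2
    simp only [pushAll, List.foldl_cons] at this ⊢
    rw [← this, update_of_ne (Ne.symm h.1), update_comm h.1]

theorem move_apply_of_notMem (S : Store) {D : List Reg} (l : List Tok) {r : Reg}
    (h : r ∉ D) : move S D l r = S r := by
  induction l generalizing S with
  | nil => rfl
  | cons a l ih => exact (ih (pushAll S D a)).trans (pushAll_apply_of_notMem S a h)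

theorem move_update_of_notMem (S : Store) {D : List Reg} (l : List Tok) {r : Reg}
    (h : r ∉ D) (l' : List Tok) : move (update S r l') D l = update (move S D l) r l' := by
  induction l generalizing S with
  | nil => rfl
  | cons a l ih =>
    have := ih (pushAll S D a)
    simp only [move, List.foldl_cons] at this ⊢
    rw [← this, pushAll_update_of_notMem S a h]

theorem move_append (S : Store) (D : List Reg) (l l' : List Tok) :
    move S D (l ++ l') = move (move S D l) D l' :=
  List.foldl_append

theorem move_cons (S : Store) (D : List Reg) (a : Tok) (l : List Tok) :
    move S D (a :: l) = move (pushAll S D a) D l := rfl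

section move
variable (e m b c n l : List Tok)

theorem move_nil : move (store e m b c n) [] l = store e m b c n := by
  induction l with
  | nil => rfl
  | cons a l ih => exact ih

theorem move_env : move (store e m b c n) [.env] l = store (l.reverse ++ e) m b c n := by
  induction l generalizing e with
  | nil => rfl
  | cons a l ih => simp [move_cons, pushAll, ih]

theorem move_main : move (store e m b c n) [.main] l = store e (l.reverse ++ m) b c n := by
  induction l generalizing m with
  | nil => rfl
  | cons a l ih => simp [move_cons, pushAll, ih]

theorem move_b : move (store e m b c n) [.b] l = store e m (l.reverse ++ b) c n := by
  induction l generalizing b with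
  | nil => rfl
  | cons a l ih => simp [move_cons, pushAll, ih]

theorem move_c : move (store e m b c n) [.c] l = store e m b (l.reverse ++ c) n := by
  induction l generalizing c with
  | nil => rfl
  | cons a l ih => simp [move_cons, pushAll, ih]

theorem move_b_c :
    move (store e m b c n) [.b, .c] l = store e m (l.reverse ++ b) (l.reverse ++ c) n := by
  induction l generalizing b c with
  | nil => rfl
  | cons a l ih => simp [move_cons, pushAll, ih]

end move

/-- The loop of `Cmd.scan`. -/
def Cmd.scanLoop (src : Reg) (D : List Reg) : Cmd :=
  .loop (fun v => v.2) (
    .pop src (fun v o => (o, v.2)) ;;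
    .push D (fun v => v.1.getD .mark) ;;
    .ite (fun v => v.1 = some .cons) (.push [.cnt] fun _ => .cons)
      (.pop .cnt fun v o => (v.1, o.isSome)))

/-- Move the S-expression on top of a stack to other stacks, in reversed order. -/
def Cmd.scan (src : Reg) (D : List Reg) : Cmd :=
  .load (fun v => (v.1, true)) ;; .scanLoop src D

/-- The stack `cnt` holds one token for each tree still to be read after the current one. A `cons`
replaces one pending tree by two and pushes a token; a leaf completes a tree and pops one, and
failure of this pop ends the loop. The statement takes the rest of the run as a hypothesis, so that
in the inductive step the run for `y` can serve as the continuation of the run for `x`. The factor 5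
counts the machine steps per token. -/
theorem Runs.scanLoop {src : Reg} {D : List Reg} (hs : src ∉ D) (hc : Reg.cnt ∉ D)
    (hsc : src ≠ .cnt) (x : SExp) :
    ∀ (S : Store) (r : List Tok) (n : ℕ) (v : Control) (S' : Store) (t : ℕ),
      S src = x.enc ++ r → S .cnt = List.replicate n .cons → v.2 = true →
      (∀ w : Control, w.2 = decide (n ≠ 0) → ∃ v', Runs (.scanLoop src D) w
        (update (update (move S D x.enc) src r) .cnt (List.replicate (n - 1) .cons)) v' S' t) →
      ∃ v', Runs (.scanLoop src D) v S v' S' (5 * x.size + t) := by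
  induction x with
  | leaf a =>
    intro S r n v S' t hS hn hv h
    have h₁ : (S src).head? = some (.leaf a) := by simp [hS, SExp.enc]
    have h₂ : (S src).tail = r := by simp [hS, SExp.enc]
    obtain ⟨v', h⟩ := h (some (.leaf a), (List.replicate n Tok.cons).head?.isSome) (by
      cases n <;> simp [List.replicate_succ])
    refine ⟨v', Runs.mono (Runs.loop_step hv (Runs.seq (Runs.pop _ _ _ _)
      (Runs.seq (Runs.push _ _ _ _) (Runs.ite_false ?_ (Runs.pop _ _ _ _)))) (u := t) ?_) ?_⟩
    · simp [h₁]
    · rw [h₁, h₂, pushAll_update_of_notMem _ _ hs, update_of_ne hsc.symm,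
        pushAll_apply_of_notMem _ _ hc, hn, List.tail_replicate]
      exact h
    · simp [SExp.size]
  | cons x y hx hy =>
    intro S r n v S' t hS hn hv h
    have h₁ : (S src).head? = some .cons := by simp [hS, SExp.enc]
    have h₂ : (S src).tail = x.enc ++ (y.enc ++ r) := by simp [hS, SExp.enc]
    have h₃ : pushAll (pushAll (update S src (S src).tail) D .cons) [.cnt] .cons =
        update (update (pushAll S D .cons) src (x.enc ++ (y.enc ++ r))) .cnt
          (List.replicate (n + 1) .cons) := by
      rw [pushAll_update_of_notMem _ _ hs, h₂]
      simp only [pushAll, List.foldl_cons, List.foldl_nil]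
      rw [update_of_ne hsc.symm]
      have := pushAll_apply_of_notMem S .cons hc
      rw [pushAll] at this
      rw [this, hn, List.replicate_succ]
    obtain ⟨v', h'⟩ := hx
      (update (update (pushAll S D .cons) src (x.enc ++ (y.enc ++ r))) .cnt
          (List.replicate (n + 1) .cons)) (y.enc ++ r) (n + 1) (some .cons, v.2) S' (5 * y.size + t)
      (by rw [update_of_ne hsc, update_self]) (by rw [update_self]) hv
      fun w hw => hy _ r n _ _ t (by rw [update_of_ne hsc, update_self]) (by rw [update_self]; simp)
        (by simpa using hw) fun w' hw' => by
          obtain ⟨v', h⟩ := h w' hw'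
          refine ⟨v', ?_⟩
          convert h using 1
          simp only [move_update_of_notMem _ _ hc, move_update_of_notMem _ _ hs, update_idem,
            update_comm hsc, SExp.enc, move_cons, move_append]
    refine ⟨v', Runs.mono (Runs.loop_step hv (Runs.seq (Runs.pop _ _ _ _)
      (Runs.seq (Runs.push _ _ _ _) (Runs.ite_true ?_ (Runs.push _ _ _ _))))
      (u := 5 * x.size + (5 * y.size + t)) ?_) ?_⟩
    · simp [h₁]
    · rw [h₁]
      exact h₃ ▸ h'
    · simp [SExp.size]; omega

/-- A program leads from a store to another one in at most `t` steps, whatever the control state. -/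
def Leads (p : Cmd) (S S' : Store) (t : ℕ) : Prop :=
  ∀ v, ∃ v', Runs p v S v' S' t

theorem Leads.mono {p : Cmd} {S S' : Store} {t u : ℕ} (h : Leads p S S' t) (htu : t ≤ u) :
    Leads p S S' u := fun v =>
  let ⟨v', h⟩ := h v
  ⟨v', h.mono htu⟩

theorem Leads.seq {p q : Cmd} {S S' S'' : Store} {t u : ℕ} (h : Leads p S S' t)
    (h' : Leads q S' S'' u) : Leads (p ;; q) S S'' (t + u) := fun v =>
  let ⟨v', h⟩ := h v
  let ⟨v'', h'⟩ := h' v'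
  ⟨v'', h.seq h'⟩

theorem Leads.push (D : List Reg) (a : Tok) (S : Store) :
    Leads (.push D fun _ => a) S (pushAll S D a) 1 := fun v => ⟨v, Runs.push D _ v S⟩

theorem Leads.scan {src : Reg} {D : List Reg} (hs : src ∉ D) (hc : Reg.cnt ∉ D)
    (hsc : src ≠ .cnt) (x : SExp) {S : Store} {r : List Tok}
    (hS : S src = x.enc ++ r) (hn : S .cnt = []) :
    Leads (.scan src D) S (update (move S D x.enc) src r) (5 * x.size + 2) := by
  intro v
  obtain ⟨v', h⟩ := Runs.scanLoop hs hc hsc x S r 0 (v.1, true)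
    (update (move S D x.enc) src r) 1 hS hn rfl fun w hw => ⟨w, by
      have h : update (update (move S D x.enc) src r) .cnt (List.replicate (0 - 1) .cons) =
          update (move S D x.enc) src r := by
        rw [update_eq_self_iff, update_of_ne hsc.symm, move_apply_of_notMem _ _ hc, hn]
        rfl
      rw [h]
      exact Runs.loop_done hw⟩
  exact ⟨v', ((Runs.load _ _ _).seq h).mono (by omega)⟩

/-- The loop of `Cmd.back`. -/
def Cmd.backLoop (src : Reg) (D : List Reg) : Cmd :=
  .loop (fun v => v.2) (
    .pop src (fun v o => (o, v.2)) ;;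
    .ite (fun v => v.1 = some .mark) (.load fun v => (v.1, false))
      (.push D (fun v => v.1.getD .mark)))

/-- Move the tokens above the topmost mark of a stack to other stacks, and delete the mark. -/
def Cmd.back (src : Reg) (D : List Reg) : Cmd :=
  .load (fun v => (v.1, true)) ;; .backLoop src D

/-- The flag is cleared on reading the mark, which is popped but not copied. As `l` contains no
mark, the loop cannot stop early. -/
theorem Runs.backLoop {src : Reg} {D : List Reg} (hs : src ∉ D) (r l : List Tok) :
    ∀ (S : Store) (v : Control), S src = l ++ .mark :: r → Tok.mark ∉ l → v.2 = true →
      ∃ v', Runs (.backLoop src D) v S v' (update (move S D l) src r) (4 * l.length + 5) := by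
  induction l with
  | nil =>
    intro S v hS _ hv
    refine ⟨((S src).head?, false), ?_⟩
    have h : update (move S D []) src r = update S src (S src).tail := by rw [hS]; rfl
    rw [h]
    exact Runs.loop_step hv (Runs.seq (Runs.pop _ _ _ _)
      (Runs.ite_true (by simp [hS]) (Runs.load _ _ _))) (Runs.loop_done rfl)
  | cons a l ih =>
    intro S v hS hl hv
    simp only [List.mem_cons, not_or] at hl
    have h₁ : (S src).head? = some a := by simp [hS]
    have h₂ : (S src).tail = l ++ .mark :: r := by simp [hS]
    obtain ⟨v', h⟩ := ih (update (pushAll S D a) src (l ++ .mark :: r)) (some a, v.2)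
      (by rw [update_self]) hl.2 hv
    refine ⟨v', Runs.mono (Runs.loop_step hv (Runs.seq (Runs.pop _ _ _ _)
      (Runs.ite_false ?_ (Runs.push _ _ _ _))) (u := 4 * l.length + 5) ?_) ?_⟩
    · simp [h₁, Ne.symm hl.1]
    · rw [h₁, h₂, pushAll_update_of_notMem _ _ hs]
      rw [move_update_of_notMem _ _ hs, update_idem] at h
      exact h
    · simp; omega

theorem Leads.back {src : Reg} {D : List Reg} (hs : src ∉ D) {S : Store} {r l : List Tok}
    (hS : S src = l ++ .mark :: r) (hl : Tok.mark ∉ l) :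
    Leads (.back src D) S (update (move S D l) src r) (4 * l.length + 6) := fun v =>
  let ⟨v', h⟩ := Runs.backLoop hs r l S (v.1, true) hS hl rfl
  ⟨v', ((Runs.load _ _ _).seq h).mono (by omega)⟩

end StackProgram

/-! ### A functional language with folds on S-expressions -/

namespace StackProgram

open PDLogic Turing Function

/-! ### Moves between the individual stacks. -/

section moves
variable (x : SExp) (e m b c : List Tok)

theorem Leads.scan_env_b : Leads (.scan .env [.b]) (store (x.enc ++ e) m b c [])
    (store e m (x.enc.reverse ++ b) c []) (5 * x.size + 2) := by
  simpa [move_b] using Leads.scan (src := .env) (D := [.b]) (by simp) (by simp) (by simp) x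
    (S := store (x.enc ++ e) m b c []) rfl rfl

theorem Leads.scan_env_b_c : Leads (.scan .env [.b, .c]) (store (x.enc ++ e) m b c [])
    (store e m (x.enc.reverse ++ b) (x.enc.reverse ++ c) []) (5 * x.size + 2) := by
  simpa [move_b_c] using Leads.scan (src := .env) (D := [.b, .c]) (by simp) (by simp) (by simp) x
    (S := store (x.enc ++ e) m b c []) rfl rfl

theorem Leads.scan_env : Leads (.scan .env []) (store (x.enc ++ e) m b c [])
    (store e m b c []) (5 * x.size + 2) := by
  simpa [move_nil] using Leads.scan (src := .env) (D := []) (by simp) (by simp) (by simp) x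
    (S := store (x.enc ++ e) m b c []) rfl rfl

theorem Leads.scan_main_b : Leads (.scan .main [.b]) (store e (x.enc ++ m) b c [])
    (store e m (x.enc.reverse ++ b) c []) (5 * x.size + 2) := by
  simpa [move_b] using Leads.scan (src := .main) (D := [.b]) (by simp) (by simp) (by simp) x
    (S := store e (x.enc ++ m) b c []) rfl rfl

theorem Leads.scan_main_c : Leads (.scan .main [.c]) (store e (x.enc ++ m) b c [])
    (store e m b (x.enc.reverse ++ c) []) (5 * x.size + 2) := by
  simpa [move_c] using Leads.scan (src := .main) (D := [.c]) (by simp) (by simp) (by simp) x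
    (S := store e (x.enc ++ m) b c []) rfl rfl

theorem Leads.scan_main : Leads (.scan .main []) (store e (x.enc ++ m) b c [])
    (store e m b c []) (5 * x.size + 2) := by
  simpa [move_nil] using Leads.scan (src := .main) (D := []) (by simp) (by simp) (by simp) x
    (S := store e (x.enc ++ m) b c []) rfl rfl

variable {l : List Tok} (hl : Tok.mark ∉ l)
include hl

theorem Leads.back_b_env : Leads (.back .b [.env]) (store e m (l ++ .mark :: b) c [])
    (store (l.reverse ++ e) m b c []) (4 * l.length + 6) := by
  simpa [move_env] using Leads.back (src := .b) (D := [.env]) (by simp)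
    (S := store e m (l ++ .mark :: b) c []) rfl hl

theorem Leads.back_c_env : Leads (.back .c [.env]) (store e m b (l ++ .mark :: c) [])
    (store (l.reverse ++ e) m b c []) (4 * l.length + 6) := by
  simpa [move_env] using Leads.back (src := .c) (D := [.env]) (by simp)
    (S := store e m b (l ++ .mark :: c) []) rfl hl

theorem Leads.back_b_main : Leads (.back .b [.main]) (store e m (l ++ .mark :: b) c [])
    (store e (l.reverse ++ m) b c []) (4 * l.length + 6) := by
  simpa [move_main] using Leads.back (src := .b) (D := [.main]) (by simp)
    (S := store e m (l ++ .mark :: b) c []) rfl hl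

theorem Leads.back_c_main : Leads (.back .c [.main]) (store e m b (l ++ .mark :: c) [])
    (store e (l.reverse ++ m) b c []) (4 * l.length + 6) := by
  simpa [move_main] using Leads.back (src := .c) (D := [.main]) (by simp)
    (S := store e m b (l ++ .mark :: c) []) rfl hl

theorem Leads.back_b : Leads (.back .b []) (store e m (l ++ .mark :: b) c [])
    (store e m b c []) (4 * l.length + 6) := by
  simpa [move_nil] using Leads.back (src := .b) (D := []) (by simp)
    (S := store e m (l ++ .mark :: b) c []) rfl hl

theorem Leads.back_c : Leads (.back .c []) (store e m b (l ++ .mark :: c) [])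
    (store e m b c []) (4 * l.length + 6) := by
  simpa [move_nil] using Leads.back (src := .c) (D := []) (by simp)
    (S := store e m b (l ++ .mark :: c) []) rfl hl

end moves

namespace SExp

theorem mark_notMem_enc_reverse (x : SExp) : Tok.mark ∉ x.enc.reverse := by
  simpa using x.mark_notMem_enc

/-- The head of a pair. -/
def hd : SExp → SExp
  | leaf _ => nil
  | cons x _ => x

/-- The tail of a pair. -/
def tl : SExp → SExp
  | leaf _ => nil
  | cons _ y => y

/-- The members of a list. -/
def toList : SExp → List SExp
  | leaf _ => []
  | cons x y => x :: y.toList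

/-- The truth value "true". -/
abbrev tru : SExp := leaf (some .top)

/-- The truth value of a proposition. -/
def ofBool (b : Bool) : SExp := if b then tru else nil

theorem size_hd_le (x : SExp) : x.hd.size ≤ x.size := by
  cases x with
  | leaf a => rfl
  | cons x y => simp only [hd, size]; omega

theorem size_tl_le (x : SExp) : x.tl.size ≤ x.size := by
  cases x with
  | leaf a => rfl
  | cons x y => simp only [tl, size]; omega

theorem size_ofBool (b : Bool) : (ofBool b).size = 1 := by
  cases b <;> rfl

theorem length_toList_lt_size (x : SExp) : x.toList.length < x.size := by
  induction x with
  | leaf a => simp [toList, size]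
  | cons x y hx hy => simp [toList, size]; omega

theorem size_lt_of_mem_toList {x y : SExp} (h : y ∈ x.toList) : y.size < x.size := by
  induction x with
  | leaf a => simp [toList] at h
  | cons x x' hx hx' =>
    simp only [toList, List.mem_cons] at h
    rcases h with rfl | h
    · simp only [size]; omega
    · have := hx' h; simp only [size]; omega

end SExp

/-- Terms of the language. Variables are de Bruijn indices; the body of `fold` sees the
accumulator as variable `0` and the current member of the list as variable `1`. -/
inductive Expr : Type
  | var (i : ℕ)
  | leaf (a : Option Symbol)
  | cons (x y : Expr)
  | hd (x : Expr)
  | tl (x : Expr)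
  | ite (x y z : Expr)
  | eq (x y : Expr)
  | bind (x b : Expr)
  | fold (l i b : Expr)

namespace Expr

/-- The value of a term in an environment. -/
def val : Expr → List SExp → SExp
  | var i, env => env.getD i SExp.nil
  | leaf a, _ => .leaf a
  | cons x y, env => .cons (x.val env) (y.val env)
  | hd x, env => (x.val env).hd
  | tl x, env => (x.val env).tl
  | ite x y z, env => if x.val env = SExp.nil then z.val env else y.val env
  | eq x y, env => SExp.ofBool (x.val env = y.val env)
  | bind x b, env => b.val (x.val env :: env)
  | fold l i b, env =>
    (l.val env).toList.foldl (fun acc x => b.val (acc :: x :: env)) (i.val env)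

/-- The evaluation of a term is well-scoped and the sizes of all intermediate values are bounded. -/
def Bdd (N : ℕ) : Expr → List SExp → Prop
  | var i, env => i < env.length
  | leaf _, _ => True
  | cons x y, env =>
    x.Bdd N env ∧ y.Bdd N env ∧ (x.val env).size + (y.val env).size + 1 ≤ N
  | hd x, env => x.Bdd N env
  | tl x, env => x.Bdd N env
  | ite x y z, env =>
    x.Bdd N env ∧ (x.val env ≠ SExp.nil → y.Bdd N env) ∧ (x.val env = SExp.nil → z.Bdd N env)
  | eq x y, env => x.Bdd N env ∧ y.Bdd N env
  | bind x b, env => x.Bdd N env ∧ b.Bdd N (x.val env :: env)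
  | fold l i b, env => l.Bdd N env ∧ i.Bdd N env ∧ ∀ p x s, (l.val env).toList = p ++ x :: s →
      b.Bdd N (p.foldl (fun acc x => b.val (acc :: x :: env)) (i.val env) :: x :: env)

/-- A bound on the running time of a term all of whose intermediate values have size at most `N`. -/
def time (N : ℕ) : Expr → ℕ
  | var i => 20 * (i + 2) * (N + 1)
  | leaf _ => 1
  | cons x y => x.time N + y.time N + 1
  | hd x => x.time N + 30 * (N + 1)
  | tl x => x.time N + 30 * (N + 1)
  | ite x y z => x.time N + y.time N + z.time N + 30 * (N + 1)
  | eq x y => x.time N + y.time N + 50 * (N + 1)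
  | bind x b => x.time N + b.time N + 30 * (N + 1)
  | fold l i b => l.time N + i.time N + (N + 1) * (b.time N + 100 * (N + 1))

/-- Induction from the right: the accumulator after a prefix of the list is a value of the body,
evaluated in exactly the environment for which `hb` supplies boundedness. -/
theorem size_foldl_le {N : ℕ} {b : Expr} {env : List SExp} {i : SExp} {L : List SExp}
    (ih : ∀ env, b.Bdd N env → (∀ v ∈ env, v.size ≤ N) → (b.val env).size ≤ N)
    (henv : ∀ v ∈ env, v.size ≤ N) (hi : i.size ≤ N) (hL : ∀ v ∈ L, v.size ≤ N)
    (hb : ∀ p x s, L = p ++ x :: s →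
      b.Bdd N (p.foldl (fun acc x => b.val (acc :: x :: env)) i :: x :: env)) :
    (L.foldl (fun acc x => b.val (acc :: x :: env)) i).size ≤ N := by
  induction L using List.reverseRecOn with
  | nil => exact hi
  | append_singleton L x ihL =>
    rw [List.foldl_append]
    have h := ihL (fun v hv => hL v (by simp [hv])) fun p y s h => hb p y (s ++ [x]) (by simp [h])
    refine ih _ (hb L x [] rfl) fun v hv => ?_
    simp only [List.mem_cons] at hv
    rcases hv with rfl | rfl | hv
    · exact h
    · exact hL _ (by simp)
    · exact henv v hv

/-- Only `cons` makes a value larger than those already present, and for it `Bdd` records the bound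
explicitly. All other results are leaves, parts of earlier values, or results of bounded subterms;
leaves account for `1 ≤ N`. -/
theorem size_val_le {N : ℕ} (hN : 1 ≤ N) (e : Expr) :
    ∀ env, e.Bdd N env → (∀ v ∈ env, v.size ≤ N) → (e.val env).size ≤ N := by
  induction e with
  | var i =>
    intro env h henv
    simp only [Bdd] at h
    simpa [val, h] using henv _ (List.getElem_mem h)
  | leaf a => intro env _ _; simpa [val, SExp.size]
  | cons x y hx hy => intro env h henv; simpa [val, SExp.size] using h.2.2
  | hd x hx => intro env h henv; exact (SExp.size_hd_le _).trans (hx env h henv)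
  | tl x hx => intro env h henv; exact (SExp.size_tl_le _).trans (hx env h henv)
  | ite x y z hx hy hz =>
    intro env h henv
    simp only [val]
    split
    · exact hz env (h.2.2 ‹_›) henv
    · exact hy env (h.2.1 ‹_›) henv
  | eq x y hx hy => intro env h henv; simpa [val, SExp.size_ofBool]
  | bind x b hx hb =>
    intro env h henv
    exact hb _ h.2 (by simpa using ⟨hx env h.1 henv, henv⟩)
  | fold l i b hl hi hb =>
    intro env h henv
    exact size_foldl_le hb henv (hi env h.2.1 henv)
      (fun v hv => (SExp.size_lt_of_mem_toList hv).le.trans (hl env h.1 henv)) h.2.2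

end Expr

/-! ### Compilation -/

namespace Cmd

/-- Skip `n` S-expressions on the stack `env`. -/
def skipEnv : ℕ → Cmd
  | 0 => .load id
  | n + 1 => .scan .env [.b] ;; skipEnv n

/-- Copy the `i`-th S-expression on the stack `env` to the stack `main`. -/
def fetch (i : ℕ) : Cmd :=
  .push [.b] (fun _ => .mark) ;; .push [.c] (fun _ => .mark) ;; skipEnv i ;;
    .scan .env [.b, .c] ;; .back .c [.main] ;; .back .b [.env]

/-- Move the S-expression on top of `main` to `env`. -/
def enter : Cmd :=
  .push [.c] (fun _ => .mark) ;; .scan .main [.c] ;; .back .c [.env]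

/-- Read the top of the stack `main`. -/
def popMain : Cmd := .pop .main fun v o => (o, v.2)

/-- Replace the pair on top of `main` by its head. -/
def head : Cmd :=
  popMain ;; .ite (fun v => v.1 = some .cons)
    (.push [.b] (fun _ => .mark) ;; .scan .main [.b] ;; .scan .main [] ;; .back .b [.main])
    (.push [.main] fun _ => .leaf none)

/-- Replace the pair on top of `main` by its tail. -/
def tail : Cmd :=
  popMain ;; .ite (fun v => v.1 = some .cons) (.scan .main []) (.push [.main] fun _ => .leaf none)

/-- Drop the S-expression on top of `main`, and choose a program by its truth value. -/
def test (p q : Cmd) : Cmd :=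
  popMain ;; .ite (fun v => v.1 = some (.leaf none)) q
    (.ite (fun v => v.1 = some .cons) (.scan .main [] ;; .scan .main []) (.load id) ;; p)

/-- Compare the tops of the stacks `b` and `c`. -/
def peekBoth : Cmd :=
  .peek .b (fun v o => (o, v.2)) ;; .peek .c fun v o => (v.1, v.1 = o ∧ o ≠ some .mark)

/-- Drop the longest common part of the stacks `b` and `c` above their topmost marks. -/
def compareLoop : Cmd :=
  .loop (fun v => v.2) (.pop .b (fun v _ => v) ;; .pop .c (fun v _ => v) ;; peekBoth)

/-- Replace the two S-expressions on top of `main` by the truth value of their equality. -/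
def compare : Cmd :=
  .push [.b] (fun _ => .mark) ;; .scan .main [.b] ;; .push [.c] (fun _ => .mark) ;;
  .scan .main [.c] ;; peekBoth ;; compareLoop ;;
  .peek .c (fun v o => (v.1, v.1 = some .mark ∧ o = some .mark)) ;;
  .push [.main] (fun v => .leaf (if v.2 then some .top else none)) ;;
  .back .b [] ;; .back .c []

/-- The loop of a fold: `env` holds the environment, `main` the rest of the list, whose first token
has been read already, and the accumulator. -/
def foldLoop (p : Cmd) : Cmd :=
  .loop (fun v => v.1 = some .cons) ((enter ;; .push [.b] (fun _ => .mark) ;; .scan .main [.b] ;;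
    enter ;; p ;; .scan .env [] ;; .scan .env [] ;; .back .b [.main]) ;; popMain)

end Cmd

/-- The program evaluating a term. -/
def Expr.compile : Expr → Cmd
  | var i => .fetch i
  | leaf a => .push [.main] fun _ => .leaf a
  | cons x y => y.compile ;; x.compile ;; .push [.main] fun _ => .cons
  | hd x => x.compile ;; .head
  | tl x => x.compile ;; .tail
  | ite x y z => x.compile ;; .test y.compile z.compile
  | eq x y => y.compile ;; x.compile ;; .compare
  | bind x b => (x.compile ;; .enter) ;; b.compile ;; .scan .env []
  | fold l i b => (i.compile ;; l.compile) ;; .popMain ;; .foldLoop b.compile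

/-- The code of an environment. -/
def encEnv (env : List SExp) : List Tok := env.flatMap SExp.enc

theorem encEnv_cons (x : SExp) (env : List SExp) : encEnv (x :: env) = x.enc ++ encEnv env := rfl

theorem mark_notMem_encEnv (env : List SExp) : Tok.mark ∉ encEnv env := by
  simp [encEnv, SExp.mark_notMem_enc]

theorem length_encEnv_le {env : List SExp} {N : ℕ} (h : ∀ v ∈ env, v.size ≤ N) :
    (encEnv env).length ≤ env.length * N := by
  induction env with
  | nil => simp [encEnv]
  | cons x env ih =>
    simp only [List.mem_cons, forall_eq_or_imp] at h
    have := ih h.2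
    simp only [encEnv, List.flatMap_cons, List.length_append, SExp.length_enc,
      List.length_cons] at this ⊢
    have := h.1
    linarith

/-! ### Effect and running time of the compiled operations. -/

section leads
variable (e m b c : List Tok)

theorem Leads.push_b : Leads (.push [.b] fun _ => .mark) (store e m b c [])
    (store e m (.mark :: b) c []) 1 := by
  simpa [pushAll] using Leads.push [.b] .mark (store e m b c [])

theorem Leads.push_c : Leads (.push [.c] fun _ => .mark) (store e m b c [])
    (store e m b (.mark :: c) []) 1 := by
  simpa [pushAll] using Leads.push [.c] .mark (store e m b c [])

theorem Leads.push_main (a : Tok) : Leads (.push [.main] fun _ => a) (store e m b c [])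
    (store e (a :: m) b c []) 1 := by
  simpa [pushAll] using Leads.push [.main] a (store e m b c [])

theorem Leads.skipEnv {N : ℕ} (env : List SExp) (h : ∀ v ∈ env, v.size ≤ N) :
    Leads (.skipEnv env.length) (store (encEnv env ++ e) m b c [])
      (store e m ((encEnv env).reverse ++ b) c []) (env.length * (5 * N + 2) + 1) := by
  induction env generalizing b with
  | nil => exact fun v => ⟨v, (Runs.load id v _).mono (by simp)⟩
  | cons x env ih =>
    simp only [List.mem_cons, forall_eq_or_imp] at h
    have h₁ := Leads.scan_env_b x (encEnv env ++ e) m b c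
    have h₂ := ih (x.enc.reverse ++ b) h.2
    have h₃ := h₁.seq h₂
    simp only [encEnv, List.flatMap_cons, List.append_assoc, List.length_cons,
      List.reverse_append] at h₃ ⊢
    refine h₃.mono ?_
    have := h.1
    linarith

/-- Each move reverses the tokens. The skipped trees and the wanted one go to `b`, a second copy of
the wanted one goes to `c`, and moving back down to the marks reverses again: from `c` comes the
copy for `main`, from `b` the restored environment. -/
theorem Leads.fetch {N : ℕ} (env : List SExp) (h : ∀ v ∈ env, v.size ≤ N) {i : ℕ}
    (hi : i < env.length) :
    Leads (.fetch i) (store (encEnv env ++ e) m b c [])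
      (store (encEnv env ++ e) ((env.getD i SExp.nil).enc ++ m) b c [])
      (20 * (i + 2) * (N + 1)) := by
  obtain ⟨p, x, s, rfl, rfl⟩ : ∃ p x s, env = p ++ x :: s ∧ i = p.length :=
    ⟨env.take i, env[i], env.drop (i + 1), by simp, by simp; omega⟩
  have hp : ∀ v ∈ p, v.size ≤ N := fun v hv => h v (by simp [hv])
  have hx : x.size ≤ N := h x (by simp)
  have h₁ := (Leads.push_b (encEnv (p ++ x :: s) ++ e) m b c).seq <|
    (Leads.push_c _ m _ c).seq <|
    (by
      simpa [encEnv] using Leads.skipEnv (encEnv (x :: s) ++ e) m (.mark :: b) (.mark :: c) p hp :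
      Leads (.skipEnv p.length) (store (encEnv (p ++ x :: s) ++ e) m (.mark :: b) (.mark :: c) [])
        (store (x.enc ++ (encEnv s ++ e)) m ((encEnv p).reverse ++ .mark :: b) (.mark :: c) [])
        (p.length * (5 * N + 2) + 1)).seq <|
    (Leads.scan_env_b_c x _ _ _ _).seq <|
    (Leads.back_c_main _ _ _ _ x.mark_notMem_enc_reverse).seq
    (by
      simpa using Leads.back_b_env (encEnv s ++ e) (x.enc.reverse.reverse ++ m) b c
        (l := x.enc.reverse ++ (encEnv p).reverse)
        (by simp [SExp.mark_notMem_enc, mark_notMem_encEnv]))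
  have h₂ := length_encEnv_le hp
  have h₃ : (encEnv p ++ (x.enc ++ (encEnv s ++ e))) = encEnv (p ++ x :: s) ++ e := by
    simp [encEnv]
  simp only [h₃] at h₁
  have h₄ : (p ++ x :: s).getD p.length SExp.nil = x := by simp
  rw [h₄]
  refine h₁.mono ?_
  simp only [List.length_reverse, SExp.length_enc]
  nlinarith

theorem Leads.enter (x : SExp) : Leads .enter (store e (x.enc ++ m) b c [])
    (store (x.enc ++ e) m b c []) (9 * x.size + 9) := by
  have h := (Leads.push_c e (x.enc ++ m) b c).seq <| (Leads.scan_main_c x _ _ _ _).seq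
    (Leads.back_c_env _ _ _ _ x.mark_notMem_enc_reverse)
  simp only [List.reverse_reverse, List.length_reverse, SExp.length_enc] at h
  exact h.mono (by omega)

theorem Runs.popMain (v : Control) (a : Tok) :
    Runs .popMain v (store e (a :: m) b c []) (some a, v.2) (store e m b c []) 1 := by
  have h := Runs.pop .main (fun v o => (o, v.2)) v (store e (a :: m) b c [])
  rwa [update_store_main] at h

theorem Leads.head (x : SExp) : Leads .head (store e (x.enc ++ m) b c [])
    (store e (x.hd.enc ++ m) b c []) (20 * x.size + 10) := by
  intro v
  cases x with
  | leaf a =>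
    obtain ⟨v', h⟩ := Leads.push_main e m b c (.leaf none) (some (.leaf a), v.2)
    exact ⟨v', ((Runs.popMain e m b c v (.leaf a)).seq (Runs.ite_false (by simp) h)).mono
      (by simp [SExp.size])⟩
  | cons x y =>
    obtain ⟨v', h⟩ := ((Leads.push_b e (x.enc ++ (y.enc ++ m)) b c).seq <|
      (Leads.scan_main_b x _ _ _ _).seq <| (Leads.scan_main y _ _ _ _).seq
      (Leads.back_b_main _ _ _ _ x.mark_notMem_enc_reverse)) (some .cons, v.2)
    simp only [List.reverse_reverse, List.length_reverse, SExp.length_enc] at h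
    simp only [SExp.enc, List.cons_append, List.append_assoc]
    exact ⟨v', ((Runs.popMain e _ b c v .cons).seq (Runs.ite_true (by simp) h)).mono
      (by simp [SExp.size]; omega)⟩

theorem Leads.tail (x : SExp) : Leads .tail (store e (x.enc ++ m) b c [])
    (store e (x.tl.enc ++ m) b c []) (20 * x.size + 10) := by
  intro v
  cases x with
  | leaf a =>
    obtain ⟨v', h⟩ := Leads.push_main e m b c (.leaf none) (some (.leaf a), v.2)
    exact ⟨v', ((Runs.popMain e m b c v (.leaf a)).seq (Runs.ite_false (by simp) h)).mono
      (by simp [SExp.size])⟩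
  | cons x y =>
    obtain ⟨v', h⟩ := Leads.scan_main x e (y.enc ++ m) b c (some .cons, v.2)
    simp only [SExp.enc, List.cons_append, List.append_assoc]
    exact ⟨v', ((Runs.popMain e _ b c v .cons).seq (Runs.ite_true (by simp) h)).mono
      (by simp [SExp.size]; omega)⟩

theorem Leads.test_nil {p q : Cmd} {S : Store} {t : ℕ} (h : Leads q (store e m b c []) S t) :
    Leads (.test p q) (store e (SExp.nil.enc ++ m) b c []) S (t + 2) := by
  intro v
  obtain ⟨v', h⟩ := h (some (.leaf none), v.2)
  exact ⟨v', ((Runs.popMain e m b c v (.leaf none)).seq (Runs.ite_true (by simp) h)).mono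
    (by omega)⟩

theorem Leads.test_of_ne_nil {p q : Cmd} {S : Store} {t : ℕ} {x : SExp} (hx : x ≠ SExp.nil)
    (h : Leads p (store e m b c []) S t) :
    Leads (.test p q) (store e (x.enc ++ m) b c []) S (t + 20 * x.size + 10) := by
  intro v
  cases x with
  | leaf a =>
    obtain ⟨v', h⟩ := h (some (.leaf a), v.2)
    refine ⟨v', ((Runs.popMain e m b c v (.leaf a)).seq (Runs.ite_false (by simpa using hx)
      (Runs.seq (Runs.ite_false (by simp) (Runs.load id _ _)) h))).mono (by simp; omega)⟩
  | cons x y =>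
    obtain ⟨v', h'⟩ := ((Leads.scan_main x e (y.enc ++ m) b c).seq
      (Leads.scan_main y _ _ _ _)) (some .cons, v.2)
    obtain ⟨v'', h⟩ := h v'
    simp only [SExp.enc, List.cons_append, List.append_assoc]
    exact ⟨v'', ((Runs.popMain e _ b c v .cons).seq (Runs.ite_false (by simp)
      (Runs.seq (Runs.ite_true (by simp) h') h))).mono (by simp [SExp.size]; omega)⟩

theorem Runs.peekBoth (v : Control) : Runs .peekBoth v (store e m b c [])
    (b.head?, b.head? = c.head? ∧ c.head? ≠ some .mark) (store e m b c []) 2 := by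
  exact (Runs.peek .b (fun v o => (o, v.2)) v (store e m b c [])).seq
    (Runs.peek .c (fun v o => (v.1, v.1 = o ∧ o ≠ some .mark)) _ (store e m b c []))

/-- `k` and `k'` are what remains above the marks once the common part has been dropped. The words
were equal exactly if both remainders are empty, that is, if both stacks show their mark; the
control still remembers the top of `b`, so only `c` has to be inspected afterwards. -/
theorem Runs.compareLoop {l : List Tok} (hl : Tok.mark ∉ l) :
    ∀ {l' : List Tok}, Tok.mark ∉ l' → ∃ k k' v, Tok.mark ∉ k ∧ Tok.mark ∉ k' ∧
      k.length ≤ l.length ∧ k'.length ≤ l'.length ∧ (l = l' ↔ k = [] ∧ k' = []) ∧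
      v.1 = (k ++ [Tok.mark]).head? ∧
      Runs .compareLoop ((l ++ .mark :: b).head?,
          (l ++ .mark :: b).head? = (l' ++ .mark :: c).head? ∧
            (l' ++ .mark :: c).head? ≠ some .mark)
        (store e m (l ++ .mark :: b) (l' ++ .mark :: c) []) v
        (store e m (k ++ .mark :: b) (k' ++ .mark :: c) []) (5 * l.length + 1) := by
  induction l with
  | nil =>
    intro l' hl'
    refine ⟨[], l', _, by simp, hl', by simp, by simp, by simp [eq_comm], ?_,
      Runs.loop_done ?_⟩
    · simp
    · cases l' with
      | nil => simp
      | cons a l' => simp at hl' ⊢; tauto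
  | cons a l ih =>
    intro l' hl'
    simp only [List.mem_cons, not_or] at hl
    by_cases h : ∃ k', l' = a :: k'
    · obtain ⟨l', rfl⟩ := h
      simp only [List.mem_cons, not_or] at hl'
      obtain ⟨k, k', v, h₁, h₂, h₃, h₄, h₅, h₆, h₇⟩ := ih hl.2 hl'.2
      refine ⟨k, k', v, h₁, h₂, h₃.trans (by simp), h₄.trans (by simp), by simpa using h₅, h₆, ?_⟩
      refine (Runs.loop_step ?_ (Runs.seq (Runs.pop _ _ _ _) (Runs.seq (Runs.pop _ _ _ _) ?_))
        h₇).mono (t := 1 + (1 + (1 + 2)) + (5 * l.length + 1)) ?_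
      · simp; tauto
      · simpa using Runs.peekBoth e m (l ++ .mark :: b) (l' ++ .mark :: c) _
      · simp; omega
    · refine ⟨a :: l, l', _, by simp; tauto, hl', by simp, by simp, ?_, ?_,
        (Runs.loop_done ?_).mono (by omega)⟩
      · simp only [reduceCtorEq, false_and, iff_false]
        exact fun h' => h ⟨l, h'.symm⟩
      · simp
      · cases l' with
        | nil => simp
        | cons a' l' =>
          simp at h ⊢
          tauto

theorem Leads.compare (x y : SExp) : Leads .compare (store e (x.enc ++ (y.enc ++ m)) b c [])
    (store e ((SExp.ofBool (x = y)).enc ++ m) b c []) (20 * (x.size + y.size) + 30) := by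
  intro v
  obtain ⟨v₁, h₁⟩ := Leads.push_b e (x.enc ++ (y.enc ++ m)) b c v
  obtain ⟨v₂, h₂⟩ := Leads.scan_main_b x e (y.enc ++ m) (.mark :: b) c v₁
  obtain ⟨v₃, h₃⟩ := Leads.push_c e (y.enc ++ m) (x.enc.reverse ++ .mark :: b) c v₂
  obtain ⟨v₄, h₄⟩ := Leads.scan_main_c y e m (x.enc.reverse ++ .mark :: b) (.mark :: c) v₃
  obtain ⟨k, k', v₅, hk, hk', hl, hl', heq, hv, h₅⟩ := Runs.compareLoop e m b c
    x.mark_notMem_enc_reverse y.mark_notMem_enc_reverse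
  obtain ⟨v₆, h₆⟩ := ((Leads.back_b e ((SExp.ofBool (x = y)).enc ++ m) b (k' ++ .mark :: c) hk).seq
    (Leads.back_c e ((SExp.ofBool (x = y)).enc ++ m) b c hk'))
    (v₅.1, v₅.1 = some Tok.mark ∧ (k' ++ .mark :: c).head? = some .mark)
  have hflag : (v₅.1 = some Tok.mark ∧ (k' ++ .mark :: c).head? = some .mark) ↔ x = y := by
    rw [hv, ← SExp.enc_inj, ← List.reverse_inj, heq]
    refine and_congr ?_ ?_
    · cases k <;> simp at hk ⊢; tauto
    · cases k' <;> simp at hk' ⊢; tauto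
  refine ⟨v₆, ((h₁.seq (h₂.seq (h₃.seq (h₄.seq ((Runs.peekBoth e m _ _ v₄).seq (h₅.seq
    ((Runs.peek _ _ _ _).seq ((Runs.push _ _ _ _).seq ?_)))))))).mono
    (t := 1 + (5 * x.size + 2 + (1 + (5 * y.size + 2 + (2 + (5 * x.enc.reverse.length + 1 +
      (1 + (1 + (4 * k.length + 6 + (4 * k'.length + 6)))))))))) ?_)⟩
  · refine cast ?_ h₆
    congr 1
    simp only [store_c, pushAll, List.foldl_cons, List.foldl_nil, store_main, update_store_main]
    simp only [hflag]
    by_cases h : x = y <;> simp [h, SExp.ofBool, SExp.enc]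
  · simp only [List.length_reverse, SExp.length_enc] at hl hl' ⊢
    omega

/-- The program evaluating a term does so within the given time. -/
theorem Expr.leads_compile {N : ℕ} (hN : 1 ≤ N) (x : Expr) :
    ∀ env, x.Bdd N env → (∀ v ∈ env, v.size ≤ N) → ∀ e m b c,
      Leads x.compile (store (encEnv env ++ e) m b c [])
        (store (encEnv env ++ e) ((x.val env).enc ++ m) b c []) (x.time N) := by
  induction x with
  | var i => intro env h henv e m b c; exact Leads.fetch e m b c env henv h
  | leaf a => intro env h henv e m b c; exact Leads.push_main _ m b c (.leaf a)
  | cons x y hx hy =>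
    intro env h henv e m b c
    have h := (hy env h.2.1 henv e m b c).seq <| (hx env h.1 henv e _ b c).seq <|
      Leads.push_main _ _ b c .cons
    simp only [val, SExp.enc, List.cons_append, List.append_assoc]
    exact h.mono (by simp only [time]; omega)
  | hd x hx =>
    intro env h henv e m b c
    have hs := size_val_le hN x env h henv
    exact ((hx env h henv e m b c).seq (Leads.head _ _ b c _)).mono (by simp only [time]; omega)
  | tl x hx =>
    intro env h henv e m b c
    have hs := size_val_le hN x env h henv
    exact ((hx env h henv e m b c).seq (Leads.tail _ _ b c _)).mono (by simp only [time]; omega)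
  | ite x y z hx hy hz =>
    intro env h henv e m b c
    have hs := size_val_le hN x env h.1 henv
    have hx := hx env h.1 henv e m b c
    by_cases hc : x.val env = SExp.nil
    · rw [hc] at hx
      simp only [val, hc, if_true]
      exact (hx.seq (Leads.test_nil _ _ b c (hz env (h.2.2 hc) henv e m b c))).mono
        (by simp only [time]; omega)
    · simp only [val, hc, if_false]
      exact (hx.seq (Leads.test_of_ne_nil _ _ b c hc (hy env (h.2.1 hc) henv e m b c))).mono
        (by simp only [time]; omega)
  | eq x y hx hy =>
    intro env h henv e m b c
    have hs := size_val_le hN x env h.1 henv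
    have hs' := size_val_le hN y env h.2 henv
    exact ((hy env h.2 henv e m b c).seq ((hx env h.1 henv e _ b c).seq
      (Leads.compare _ _ b c _ _))).mono (by simp only [time]; omega)
  | bind x y hx hy =>
    intro env h henv e m b c
    have hs := size_val_le hN x env h.1 henv
    have h₁ := (hx env h.1 henv e m b c).seq (Leads.enter _ m b c _)
    have h₂ := hy _ h.2 (List.forall_mem_cons.2 ⟨hs, henv⟩) e m b c
    rw [encEnv_cons, List.append_assoc] at h₂
    exact (h₁.seq (h₂.seq (Leads.scan_env _ _ _ b c))).mono (by simp only [time]; omega)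
  | fold l i y hl hi hy =>
    intro env h henv e m b c
    have hsl := size_val_le hN l env h.1 henv
    have hsi := size_val_le hN i env h.2.1 henv
    -- Loop invariant: `p` has been processed, `r` is the rest of the list. The first token of `r`
    -- is held by the control, where it decides whether to go on, so `main` contains only
    -- `r.enc.tail` above the accumulator.
    have key : ∀ (r : SExp) (p : List SExp), (l.val env).toList = p ++ r.toList → r.size ≤ N →
        ∀ v : Control, v.1 = r.enc.head? → ∃ v', Runs (.foldLoop y.compile) v
          (store (encEnv env ++ e) (r.enc.tail ++
            ((p.foldl (fun acc x => y.val (acc :: x :: env)) (i.val env)).enc ++ m)) b c []) v'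
          (store (encEnv env ++ e) (((fold l i y).val env).enc ++ m) b c [])
          (r.toList.length * (y.time N + 100 * (N + 1)) + 1) := by
      intro r
      induction r with
      | leaf a =>
        intro p hp hr v hv
        refine ⟨v, Runs.mono (t := 1) ?_ (by simp)⟩
        have h : (fold l i y).val env =
            p.foldl (fun acc x => y.val (acc :: x :: env)) (i.val env) := by
          simp [val, hp, SExp.toList]
        rw [h]
        exact Runs.loop_done (by simp [hv, SExp.enc])
      | cons x r hx hr =>
        intro p hp hxr v hv
        set acc := p.foldl (fun acc x => y.val (acc :: x :: env)) (i.val env) with hacc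
        have hsx : x.size ≤ N := by simp only [SExp.size] at hxr; omega
        have hsr : r.size ≤ N := by simp only [SExp.size] at hxr; omega
        have hby := h.2.2 p x r.toList hp
        have hsacc : acc.size ≤ N := size_foldl_le (fun env => size_val_le hN y env) henv hsi
          (fun v hv => (SExp.size_lt_of_mem_toList (x := l.val env)
            (by rw [hp]; simp [hv])).le.trans hsl)
          fun p' x' s' h' => h.2.2 p' x' (s' ++ x :: r.toList) (by rw [hp, h']; simp [SExp.toList])
        have henv' : ∀ v ∈ acc :: x :: env, v.size ≤ N := by simpa using ⟨hsacc, hsx, henv⟩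
        have hby' := hy _ hby henv' e m (r.enc.reverse ++ .mark :: b) c
        simp only [encEnv_cons, List.append_assoc] at hby'
        obtain ⟨v₁, h₁⟩ := ((Leads.enter (encEnv env ++ e) (r.enc ++ (acc.enc ++ m)) b c x).seq <|
          (Leads.push_b _ _ b c).seq <| (Leads.scan_main_b r _ _ _ c).seq <|
          (Leads.enter _ m _ c acc).seq <| hby'.seq <| (Leads.scan_env acc _ _ _ c).seq <|
          (Leads.scan_env x _ _ _ c).seq <|
          Leads.back_b_main _ _ b c r.mark_notMem_enc_reverse) v
        obtain ⟨a, k, hak⟩ : ∃ a k, r.enc = a :: k := by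
          cases r <;> simp [SExp.enc]
        have h₂ := Runs.popMain (encEnv env ++ e)
          (k ++ ((y.val (acc :: x :: env)).enc ++ m)) b c v₁ a
        obtain ⟨v₃, h₃⟩ := hr (p ++ [x]) (by simpa [SExp.toList] using hp) hsr (some a, v₁.2)
          (by simp [hak])
        rw [List.foldl_append, hak] at h₃
        refine ⟨v₃, ?_⟩
        rw [List.reverse_reverse, hak] at h₁
        have h₄ := Runs.loop_step (c := fun v => v.1 = some .cons) (by simp [hv, SExp.enc])
          (h₁.seq h₂) h₃
        have h₅ : x.enc ++ (a :: k ++ (acc.enc ++ m)) =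
            (x.cons r).enc.tail ++ (acc.enc ++ m) := by simp [SExp.enc, hak]
        rw [h₅, ← hak] at h₄
        refine h₄.mono ?_
        simp only [SExp.toList, List.length_cons, List.length_reverse, SExp.length_enc, Nat.add_mul,
          Nat.one_mul]
        omega
    intro v
    obtain ⟨v₁, h₁⟩ := ((hi env h.2.1 henv e m b c).seq (hl env h.1 henv e _ b c)) v
    obtain ⟨a, k, hak⟩ : ∃ a k, (l.val env).enc = a :: k := by
      cases l.val env <;> simp [SExp.enc]
    obtain ⟨v₂, h₂⟩ := key (l.val env) [] rfl hsl (some a, v₁.2) (by simp [hak])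
    rw [hak] at h₁ h₂
    have h₃ := Runs.popMain (encEnv env ++ e) (k ++ ((i.val env).enc ++ m)) b c v₁ a
    refine ⟨v₂, (h₁.seq (h₃.seq h₂)).mono ?_⟩
    have h₄ := (SExp.length_toList_lt_size (l.val env)).le.trans hsl
    have h₅ := Nat.mul_le_mul_right (y.time N + 100 * (N + 1)) h₄
    simp only [time, Nat.add_mul, Nat.one_mul] at h₅ ⊢
    omega

end leads

/-- The running time is polynomial in the bound on the sizes. -/
theorem Expr.time_le (x : Expr) : ∃ k d, ∀ N, x.time N ≤ k * (N + 1) ^ d := by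
  have mono : ∀ {k d N : ℕ} (k' d' : ℕ), k ≤ k' → d ≤ d' →
      k * (N + 1) ^ d ≤ k' * (N + 1) ^ d' := fun k' d' hk hd =>
    Nat.mul_le_mul hk (Nat.pow_le_pow_right (by omega) hd)
  induction x with
  | var i => exact ⟨20 * (i + 2), 1, fun N => by simp [time]⟩
  | leaf a => exact ⟨1, 0, fun N => by simp [time]⟩
  | cons x y hx hy =>
    obtain ⟨k, d, h⟩ := hx
    obtain ⟨k', d', h'⟩ := hy
    refine ⟨k + k' + 1, d + d', fun N => ?_⟩
    have h₁ := (h N).trans (mono k (d + d') le_rfl (by omega))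
    have h₂ := (h' N).trans (mono k' (d + d') le_rfl (by omega))
    have h₃ : 1 ≤ (N + 1) ^ (d + d') := Nat.one_le_pow _ _ (by omega)
    simp only [time]
    linarith
  | hd x hx =>
    obtain ⟨k, d, h⟩ := hx
    refine ⟨k + 30, d + 1, fun N => ?_⟩
    have h₁ := (h N).trans (mono k (d + 1) le_rfl (by omega))
    have h₃ := mono (k := 30) (d := 1) (N := N) 30 (d + 1) le_rfl (by omega)
    simp only [time]
    linarith
  | tl x hx =>
    obtain ⟨k, d, h⟩ := hx
    refine ⟨k + 30, d + 1, fun N => ?_⟩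
    have h₁ := (h N).trans (mono k (d + 1) le_rfl (by omega))
    have h₃ := mono (k := 30) (d := 1) (N := N) 30 (d + 1) le_rfl (by omega)
    simp only [time]
    linarith
  | ite x y z hx hy hz =>
    obtain ⟨k, d, h⟩ := hx
    obtain ⟨k', d', h'⟩ := hy
    obtain ⟨k'', d'', h''⟩ := hz
    refine ⟨k + k' + k'' + 30, d + d' + d'' + 1, fun N => ?_⟩
    have h₁ := (h N).trans (mono k (d + d' + d'' + 1) le_rfl (by omega))
    have h₂ := (h' N).trans (mono k' (d + d' + d'' + 1) le_rfl (by omega))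
    have h₃ := (h'' N).trans (mono k'' (d + d' + d'' + 1) le_rfl (by omega))
    have h₄ := mono (k := 30) (d := 1) (N := N) 30 (d + d' + d'' + 1) le_rfl (by omega)
    simp only [time]
    linarith
  | eq x y hx hy =>
    obtain ⟨k, d, h⟩ := hx
    obtain ⟨k', d', h'⟩ := hy
    refine ⟨k + k' + 50, d + d' + 1, fun N => ?_⟩
    have h₁ := (h N).trans (mono k (d + d' + 1) le_rfl (by omega))
    have h₂ := (h' N).trans (mono k' (d + d' + 1) le_rfl (by omega))
    have h₃ := mono (k := 50) (d := 1) (N := N) 50 (d + d' + 1) le_rfl (by omega)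
    simp only [time]
    linarith
  | bind x y hx hy =>
    obtain ⟨k, d, h⟩ := hx
    obtain ⟨k', d', h'⟩ := hy
    refine ⟨k + k' + 30, d + d' + 1, fun N => ?_⟩
    have h₁ := (h N).trans (mono k (d + d' + 1) le_rfl (by omega))
    have h₂ := (h' N).trans (mono k' (d + d' + 1) le_rfl (by omega))
    have h₃ := mono (k := 30) (d := 1) (N := N) 30 (d + d' + 1) le_rfl (by omega)
    simp only [time]
    linarith
  | fold l i y hl hi hy =>
    obtain ⟨k, d, h⟩ := hl
    obtain ⟨k', d', h'⟩ := hi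
    obtain ⟨k'', d'', h''⟩ := hy
    refine ⟨k + k' + k'' + 100, d + d' + d'' + 2, fun N => ?_⟩
    have h₁ := (h N).trans (mono k (d + d' + d'' + 2) le_rfl (by omega))
    have h₂ := (h' N).trans (mono k' (d + d' + d'' + 2) le_rfl (by omega))
    have h₃ := Nat.mul_le_mul_left (N + 1) (h'' N)
    have h₄ := mono (k := k'') (d := d'' + 1) (N := N) k'' (d + d' + d'' + 2) le_rfl (by omega)
    have h₅ := mono (k := 100) (d := 2) (N := N) 100 (d + d' + d'' + 2) le_rfl (by omega)
    simp only [time]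
    have h₆ : k'' * (N + 1) ^ (d'' + 1) = (N + 1) * (k'' * (N + 1) ^ d'') := by ring
    have h₇ : 100 * (N + 1) ^ 2 = (N + 1) * (100 * (N + 1)) := by ring
    linarith

end StackProgram

/-! ### The machine evaluating a term on a word -/

namespace StackProgram

open PDLogic Turing Function

/-- A word as a list, whose head is the last symbol of the word. -/
def ofWord (w : List Symbol) : SExp :=
  w.foldl (fun x a => .cons (.leaf (some a)) x) SExp.nil

/-- The labels of the machine evaluating a program. -/
inductive MachineLabel (p : Cmd) : Type
  | start | read
  | prog (l : p.Label)
  | write | clear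

noncomputable instance (p : Cmd) : Fintype (MachineLabel p) :=
  letI := p.labelFintype
  letI := Classical.decEq (MachineLabel p)
  Fintype.ofSurjective (α := Option (Option (Option (Option p.Label))))
    (fun o => match o with
      | none => .start
      | some none => .read
      | some (some none) => .write
      | some (some (some none)) => .clear
      | some (some (some (some l))) => .prog l)
    (fun l => by
      cases l with
      | start => exact ⟨none, rfl⟩
      | read => exact ⟨some none, rfl⟩
      | write => exact ⟨some (some none), rfl⟩
      | clear => exact ⟨some (some (some none)), rfl⟩
      | prog l => exact ⟨some (some (some (some l))), rfl⟩)

/-- The machine code: the input is moved to the stack `env`, the program is run, and the truth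
value on top of the stack `main` is written on the output stack. -/
def machineCode (p : Cmd) : MachineLabel p → TM2.Stmt Alphabet (MachineLabel p) Control
  | .start => .push (.reg .env) (fun _ => .leaf none) (.goto fun _ => .read)
  | .read => .pop .inp (fun v o => (o.map fun a => .leaf (some a), v.2)) <|
      .branch (fun v => v.1 = none) (.goto fun _ => .prog p.entry) <|
      .push (.reg .env) (fun v => v.1.getD .mark) <| .push (.reg .env) (fun _ => .cons) <|
      .goto fun _ => .read
  | .prog l => p.code .prog .write l
  | .write => .pop (.reg .main) (fun v o => (o, v.2)) <|
      .push .out (fun v => (v.1 ≠ some (.leaf none) : Bool)) <| .goto fun _ => .clear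
  | .clear => .pop (.reg .env) (fun v o => (o, v.2)) <|
      .branch (fun v => v.1 = none) (.load (fun _ => (none, false)) .halt) <|
      .goto fun _ => .clear

/-- The machine evaluating a program. -/
noncomputable def machine (p : Cmd) : TM2ComputableAux Symbol Bool where
  tm :=
    { K := Stack
      k₀ := .inp
      k₁ := .out
      Γ := Alphabet
      Λ := MachineLabel p
      main := .start
      σ := Control
      initialState := (none, false)
      Γk₀Fin := inferInstanceAs (Fintype Symbol)
      m := machineCode p }
  inputAlphabet := Equiv.refl _
  outputAlphabet := Equiv.refl _

theorem update_assemble_inp (I I' : List Symbol) (O : List Bool) (S : Store) :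
    update (assemble I O S) .inp I' = assemble I' O S := by
  funext k
  cases k with
  | inp => exact update_self _ _ _
  | out => exact update_of_ne (by simp) _ _
  | reg r => exact update_of_ne (by simp) _ _

theorem update_assemble_out (I : List Symbol) (O O' : List Bool) (S : Store) :
    update (assemble I O S) .out O' = assemble I O' S := by
  funext k
  cases k with
  | inp => exact update_of_ne (by simp) _ _
  | out => exact update_self _ _ _
  | reg r => exact update_of_ne (by simp) _ _

/-- Every symbol read is put in front of the list built so far, so the last symbol of the word
becomes its head. This is why the program sees the word from right to left. -/
theorem reachIn_read (p : Cmd) (w : List Symbol) (x : SExp) (v : Control) : ∃ v',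
    ReachIn (machineCode p) ⟨some .read, v, assemble w [] (store x.enc [] [] [] [])⟩
      ⟨some (.prog p.entry), v',
        assemble [] []
          (store (w.foldl (fun x a => SExp.cons (.leaf (some a)) x) x).enc [] [] [] [])⟩
      (w.length + 1) := by
  induction w generalizing x v with
  | nil =>
    refine ⟨(none, v.2), ReachIn.single ?_⟩
    have h := update_assemble_inp [] [] [] (store x.enc [] [] [] [])
    simp only [List.foldl_nil]
    nth_rw 2 [← h]
    rfl
  | cons a w ih =>
    obtain ⟨v', h⟩ := ih (SExp.cons (.leaf (some a)) x) (some (.leaf (some a)), v.2)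
    refine ⟨v', ((ReachIn.single ?_).trans h).mono (by simp; omega)⟩
    have h : assemble w [] (store (SExp.cons (.leaf (some a)) x).enc [] [] [] []) =
        update (update (update (assemble (a :: w) [] (store x.enc [] [] [] [])) .inp w)
          (.reg .env) (.leaf (some a) :: x.enc)) (.reg .env)
          (.cons :: .leaf (some a) :: x.enc) := by
      rw [update_assemble_inp, update_assemble_reg, update_assemble_reg]
      simp [SExp.enc]
    rw [h]
    simp [machineCode, assemble]

/-- Output of a machine requires all stacks except the output stack to be empty and the control to
be in its initial state. At this point only the environment is left over. -/
theorem reachIn_clear (p : Cmd) (e : List Tok) (O : List Bool) (v : Control) :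
    ReachIn (machineCode p) ⟨some .clear, v, assemble [] O (store e [] [] [] [])⟩
      ⟨none, (none, false), assemble [] O (store [] [] [] [] [])⟩ (e.length + 1) := by
  induction e generalizing v with
  | nil =>
    refine ReachIn.single ?_
    have h := update_assemble_reg [] O (store [] [] [] [] []) .env []
    rw [update_store_env] at h
    nth_rw 2 [← h]
    rfl
  | cons a e ih =>
    refine ((ReachIn.single ?_).trans (ih (some a, v.2))).mono (by simp; omega)
    have h := update_assemble_reg [] O (store (a :: e) [] [] [] []) .env e
    rw [update_store_env] at h
    rw [← h]
    rfl

/-- The machine of a term yielding a truth value computes this value. -/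
theorem machine_outputs {N : ℕ} (hN : 1 ≤ N) (x : Expr) (w : List Symbol) (r : Bool)
    (hw : (ofWord w).size ≤ N) (hx : x.Bdd N [ofWord w])
    (hr : x.val [ofWord w] = SExp.ofBool r) :
    Nonempty (TM2OutputsInTime (machine x.compile).tm
      (w.map (machine x.compile).inputAlphabet.symm)
      (some ((Computability.encodeBool r).map (machine x.compile).outputAlphabet.symm))
      (x.time N + w.length + N + 10)) := by
  have key : ReachIn (machineCode x.compile)
      ⟨some .start, (none, false), assemble w [] (store [] [] [] [] [])⟩
      ⟨none, (none, false), assemble [] [r] (store [] [] [] [] [])⟩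
      (x.time N + w.length + N + 10) := by
    have h₁ : ReachIn (machineCode x.compile)
        ⟨some .start, (none, false), assemble w [] (store [] [] [] [] [])⟩
        ⟨some .read, (none, false), assemble w [] (store SExp.nil.enc [] [] [] [])⟩ 1 := by
      refine ReachIn.single ?_
      have h := update_assemble_reg w [] (store [] [] [] [] []) .env [.leaf none]
      rw [update_store_env] at h
      simp only [SExp.enc]
      rw [← h]
      rfl
    obtain ⟨v₁, h₂⟩ := reachIn_read x.compile w SExp.nil (none, false)
    obtain ⟨v₂, h₃⟩ := Expr.leads_compile hN x [ofWord w] hx (by simpa using hw) [] [] [] [] v₁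
    have h₃ := h₃ (machineCode x.compile) .prog .write (fun _ => rfl) [] []
    have h₄ : ReachIn (machineCode x.compile)
        ⟨some .write, v₂, assemble [] [] (store (ofWord w).enc (SExp.ofBool r).enc [] [] [])⟩
        ⟨some .clear, ((SExp.ofBool r).enc.head?, v₂.2),
          assemble [] [r] (store (ofWord w).enc [] [] [] [])⟩ 1 := by
      refine ReachIn.single ?_
      have h := update_assemble_reg [] [] (store (ofWord w).enc (SExp.ofBool r).enc [] [] [])
        .main []
      rw [update_store_main] at h
      rw [← update_assemble_out [] [] [r], ← h]
      cases r <;> rfl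
    have h₅ := reachIn_clear x.compile (ofWord w).enc [r] ((SExp.ofBool r).enc.head?, v₂.2)
    simp only [encEnv, List.flatMap_cons, List.flatMap_nil, List.append_nil, hr] at h₃
    refine (h₁.trans (h₂.trans (h₃.trans (h₄.trans h₅)))).mono ?_
    rw [SExp.length_enc]
    omega
  obtain ⟨n, hn, h⟩ := key
  refine ⟨⟨⟨n, ?_⟩, hn⟩⟩
  have hi : initList (machine x.compile).tm (w.map (machine x.compile).inputAlphabet.symm) =
      ⟨some .start, (none, false), assemble w [] (store [] [] [] [] [])⟩ := by
    have hw : w.map (machine x.compile).inputAlphabet.symm = w := List.map_id w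
    rw [hw]
    refine congrArg (TM2.Cfg.mk _ _) (funext fun k => ?_)
    rcases k with _ | _ | k
    · rfl
    · rfl
    · cases k <;> rfl
  have ho : haltList (machine x.compile).tm
      ((Computability.encodeBool r).map (machine x.compile).outputAlphabet.symm) =
      ⟨none, (none, false), assemble [] [r] (store [] [] [] [] [])⟩ := by
    refine congrArg (TM2.Cfg.mk _ _) (funext fun k => ?_)
    rcases k with _ | _ | k
    · rfl
    · rfl
    · cases k <;> rfl
  rw [hi, Option.map_some, ho]
  exact h

end StackProgram

/-! ### The model checking program -/

namespace StackProgram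

open PDLogic Turing Function

namespace SExp

open Classical in
/-- The truth value of a proposition. -/
noncomputable def ofProp (p : Prop) : SExp := if p then tru else nil

theorem ofProp_true {p : Prop} (h : p) : ofProp p = tru := if_pos h

theorem ofProp_false {p : Prop} (h : ¬p) : ofProp p = nil := if_neg h

theorem ofProp_inj {p q : Prop} : ofProp p = ofProp q ↔ (p ↔ q) := by
  by_cases h : p <;> by_cases h' : q <;> simp [ofProp, h, h']

theorem ofProp_congr {p q : Prop} (h : p ↔ q) : ofProp p = ofProp q := by rw [propext h]

theorem ofBool_eq_ofProp {p : Prop} [Decidable p] : ofBool p = ofProp p := by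
  by_cases h : p <;> simp [ofProp, ofBool, h]

open Classical in
/-- The members of a list with a given property, in reversed order. -/
noncomputable def filter (l : SExp) (p : SExp → Prop) : SExp :=
  l.toList.foldl (fun acc x => if p x then .cons x acc else acc) nil

theorem mem_foldl_filter {L : List SExp} {p : SExp → Prop} [DecidablePred p] {acc x : SExp} :
    x ∈ (L.foldl (fun acc x => if p x then SExp.cons x acc else acc) acc).toList ↔
      (x ∈ L ∧ p x) ∨ x ∈ acc.toList := by
  induction L generalizing acc with
  | nil => simp
  | cons y L ih =>
    rw [List.foldl_cons, ih]
    by_cases h : p y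
    · simp only [h, if_true, toList, List.mem_cons]
      constructor
      · rintro (h' | rfl | h') <;> tauto
      · rintro (⟨rfl | h', h''⟩ | h') <;> tauto
    · simp only [h, if_false, List.mem_cons]
      constructor
      · rintro (h' | h') <;> tauto
      · rintro (⟨rfl | h', h''⟩ | h') <;> tauto

theorem mem_filter {l : SExp} {p : SExp → Prop} {x : SExp} :
    x ∈ (l.filter p).toList ↔ x ∈ l.toList ∧ p x := by
  classical
  rw [filter, mem_foldl_filter]
  simp [toList]

/-- The list of all sublists. -/
def powerset (l : SExp) : SExp :=
  l.toList.foldl (fun (U r : SExp) => U.toList.foldl (fun acc S => .cons (.cons r S) acc) U)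
    (.cons nil nil)

theorem toList_foldl_cons (r : SExp) (L : List SExp) (acc : SExp) :
    (L.foldl (fun acc S => SExp.cons (.cons r S) acc) acc).toList =
      (L.map (SExp.cons r)).reverse ++ acc.toList := by
  induction L generalizing acc with
  | nil => simp
  | cons S L ih => simp [ih, toList]

end SExp

namespace Expr

/-- Negation. -/
def not (x : Expr) : Expr := .ite x (.leaf none) (.leaf (some .top))

/-- Disjunction. -/
def or (x y : Expr) : Expr := .ite x (.leaf (some .top)) y

/-- Bounded existential quantification. -/
def any (l b : Expr) : Expr := .fold l (.leaf none) (.ite b (.leaf (some .top)) (.var 0))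

/-- Bounded universal quantification. -/
def all (l b : Expr) : Expr := .fold l (.leaf (some .top)) (.ite b (.var 0) (.leaf none))

/-- The members of a list passing a test. -/
def filter (l b : Expr) : Expr :=
  .fold l (.leaf none) (.ite b (.cons (.var 1) (.var 0)) (.var 0))

/-- The list of all sublists of a list. -/
def powerset (l : Expr) : Expr :=
  .fold l (.cons (.leaf none) (.leaf none))
    (.fold (.var 0) (.var 0) (.cons (.cons (.var 3) (.var 1)) (.var 0)))

variable {env : List SExp} {p q : Prop} {P : SExp → Prop}

theorem val_eq (x y : Expr) : (eq x y).val env = SExp.ofProp (x.val env = y.val env) :=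
  SExp.ofBool_eq_ofProp

theorem val_eq_iff {x y : Expr} (hx : x.val env = SExp.ofProp p) (hy : y.val env = SExp.ofProp q) :
    (eq x y).val env = SExp.ofProp (p ↔ q) := by
  rw [val_eq, hx, hy]
  exact SExp.ofProp_congr SExp.ofProp_inj

theorem val_not {x : Expr} (hx : x.val env = SExp.ofProp p) :
    x.not.val env = SExp.ofProp ¬p := by
  by_cases h : p <;> simp [not, val, hx, SExp.ofProp, h]

theorem val_or {x y : Expr} (hx : x.val env = SExp.ofProp p) (hy : y.val env = SExp.ofProp q) :
    (x.or y).val env = SExp.ofProp (p ∨ q) := by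
  simp only [or, val, hx, hy]
  by_cases h : p
  · simp [SExp.ofProp_true h, SExp.ofProp_true (Or.inl h : p ∨ q)]
  · simp only [SExp.ofProp_false h, if_true]
    exact SExp.ofProp_congr (by tauto)

/-- The body is evaluated with the accumulator in scope, hence the demand that its truth value
depend on the member alone. The fold is then the disjunction over the members. -/
theorem val_any {l b : Expr} (h : ∀ acc x, b.val (acc :: x :: env) = SExp.ofProp (P x)) :
    (any l b).val env = SExp.ofProp (∃ x ∈ (l.val env).toList, P x) := by
  simp only [any, val, h, List.getD_cons_zero]
  induction (l.val env).toList using List.reverseRecOn with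
  | nil => simp [SExp.ofProp]
  | append_singleton L x ih =>
    simp only [List.foldl_append, ih, List.foldl_cons, List.foldl_nil, List.mem_append,
      List.mem_singleton, or_and_right, exists_or, exists_eq_left]
    by_cases h : P x
    · simp [SExp.ofProp_true h, SExp.ofProp_true (Or.inr h : (∃ x ∈ L, P x) ∨ P x)]
    · simp only [SExp.ofProp_false h, if_true]
      exact SExp.ofProp_congr (or_iff_left h).symm

theorem val_all {l b : Expr} (h : ∀ acc x, b.val (acc :: x :: env) = SExp.ofProp (P x)) :
    (all l b).val env = SExp.ofProp (∀ x ∈ (l.val env).toList, P x) := by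
  simp only [all, val, h, List.getD_cons_zero]
  induction (l.val env).toList using List.reverseRecOn with
  | nil => simp [SExp.ofProp]
  | append_singleton L x ih =>
    simp only [List.foldl_append, ih, List.foldl_cons, List.foldl_nil, List.mem_append,
      List.mem_singleton, or_imp, forall_and, forall_eq]
    by_cases h : P x
    · simp only [SExp.ofProp_true h, reduceCtorEq, SExp.leaf.injEq, if_false]
      exact SExp.ofProp_congr (by tauto)
    · simp [SExp.ofProp_false h, SExp.ofProp_false (fun h' => h h'.2 : ¬((∀ x ∈ L, P x) ∧ P x))]

theorem val_filter {l b : Expr} (h : ∀ acc x, b.val (acc :: x :: env) = SExp.ofProp (P x)) :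
    (filter l b).val env = (l.val env).filter P := by
  simp only [filter, val, h, List.getD_cons_zero, List.getD_cons_succ, SExp.filter]
  congr 1
  funext acc x
  by_cases h : P x <;> simp [SExp.ofProp, h]

end Expr

/-- The state of the program: the rows of the team read so far (each row is the list of its true
variables), the list of all subteams, two lists of variables being read, and the stack of the tables
of subformulas. -/
abbrev mkState (R U c p st : SExp) : SExp := .cons R (.cons U (.cons c (.cons p st)))

/-! ### The terms of the program; each filter or bounded quantifier shifts the indices by two. -/

section program

/-- A term for the rows, if variable `d` is the state. -/
abbrev rowsE (d : ℕ) : Expr := .hd (.var d)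
/-- A term for the subteams, if variable `d` is the state. -/
abbrev subteamsE (d : ℕ) : Expr := .hd (.tl (.var d))
/-- A term for the first list of variables, if variable `d` is the state. -/
abbrev curE (d : ℕ) : Expr := .hd (.tl (.tl (.var d)))
/-- A term for the second list of variables, if variable `d` is the state. -/
abbrev prevE (d : ℕ) : Expr := .hd (.tl (.tl (.tl (.var d))))
/-- A term for the stack of tables, if variable `d` is the state. -/
abbrev stackE (d : ℕ) : Expr := .tl (.tl (.tl (.tl (.var d))))
/-- A term for a state. -/
abbrev mkE (R U c p st : Expr) : Expr := .cons R (.cons U (.cons c (.cons p st)))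
/-- The term for the empty list. -/
abbrev nilE : Expr := .leaf none

/-- Whether variable `x` is a member of variable `l`. -/
abbrev memE (x l : ℕ) : Expr := .any (.var l) (.eq (.var 1) (.var (x + 2)))

/-- The table of a literal. -/
def literalE (f : Expr → Expr) : Expr :=
  Expr.filter (subteamsE 0) <| Expr.all (.var 1) <| f <|
    Expr.any (.var 1) <| .eq (.var 1) (.hd (curE 6))

/-- The table of a conjunction. -/
def andE : Expr :=
  Expr.filter (.hd (stackE 0)) <| Expr.any (.hd (.tl (stackE 2))) <| .eq (.var 1) (.var 3)

/-- The table of a disjunction. -/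
def orE : Expr :=
  Expr.filter (subteamsE 0) <| Expr.any (.hd (stackE 2)) <| Expr.any (.hd (.tl (stackE 4))) <|
    Expr.all (.var 5) <|
    Expr.or (memE 1 5) (memE 1 3)

/-- The table of a dependence atom. -/
def depE : Expr :=
  Expr.filter (subteamsE 0) <| Expr.all (.var 1) <| Expr.all (.var 3) <|
    Expr.or (Expr.any (curE 6) (Expr.not (.eq (memE 1 3) (memE 1 5))))
      (Expr.all (prevE 6) (.eq (memE 1 3) (memE 1 5)))

/-- The table of a negated dependence atom. -/
def negDepE : Expr := Expr.filter (subteamsE 0) <| Expr.all (.var 1) nilE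

/-- The new state after reading a symbol, if variable `0` is the state and variable `1` the
symbol. -/
def branchE : Symbol → Expr
  | .top => mkE (rowsE 0) (subteamsE 0) nilE nilE (.cons (subteamsE 0) (stackE 0))
  | .bot => mkE (rowsE 0) (subteamsE 0) nilE nilE (.cons nilE (stackE 0))
  | .var => mkE (rowsE 0) (subteamsE 0) nilE nilE (.cons (literalE id) (stackE 0))
  | .negVar => mkE (rowsE 0) (subteamsE 0) nilE nilE (.cons (literalE Expr.not) (stackE 0))
  | .or => mkE (rowsE 0) (subteamsE 0) nilE nilE (.cons orE (.tl (.tl (stackE 0))))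
  | .and => mkE (rowsE 0) (subteamsE 0) nilE nilE (.cons andE (.tl (.tl (stackE 0))))
  | .dep => mkE (rowsE 0) (subteamsE 0) nilE nilE (.cons depE (stackE 0))
  | .negDep => mkE (rowsE 0) (subteamsE 0) nilE nilE (.cons negDepE (stackE 0))
  | .digit _ => mkE (rowsE 0) (subteamsE 0) (.cons (.cons (.var 1) (.hd (curE 0))) (.tl (curE 0)))
      (prevE 0) (stackE 0)
  | .endNumber => mkE (rowsE 0) (subteamsE 0) (.cons nilE (curE 0)) (prevE 0) (stackE 0)
  | .endSet => mkE (rowsE 0) (subteamsE 0) nilE (curE 0) (stackE 0)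
  | .endFormula => mkE (rowsE 0) (Expr.powerset (rowsE 0)) nilE nilE nilE
  | .value true => mkE (.cons (.cons (.hd (curE 0)) (.hd (rowsE 0))) (.tl (rowsE 0))) (subteamsE 0)
      nilE nilE (stackE 0)
  | .value false => mkE (rowsE 0) (subteamsE 0) nilE nilE (stackE 0)
  | .endRow => mkE (.cons nilE (rowsE 0)) (subteamsE 0) nilE nilE (stackE 0)

/-- Case distinction on the symbol which is variable `1`. -/
def switchE (f : Symbol → Expr) (L : List Symbol) : Expr :=
  L.foldr (fun a e => .ite (.eq (.var 1) (.leaf (some a))) (f a) e) nilE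

/-- The main loop. -/
noncomputable def loopE : Expr :=
  .fold (.var 0) (mkE nilE nilE nilE nilE nilE) (switchE branchE Finset.univ.toList)

/-- Whether the table on top of the stack has a member which contains all rows. -/
def answerE : Expr := Expr.any (.hd (stackE 0)) <| Expr.all (rowsE 2) <| memE 1 3

/-- The model checking program. -/
noncomputable def programE : Expr := .bind loopE answerE

end program

theorem val_switchE {f : Symbol → Expr} {L : List Symbol} {a : Symbol} (ha : a ∈ L) (s : SExp)
    (env : List SExp) :
    (switchE f L).val (s :: .leaf (some a) :: env) = (f a).val (s :: .leaf (some a) :: env) := by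
  induction L with
  | nil => simp at ha
  | cons b L ih =>
    simp only [switchE, List.foldr_cons, Expr.val]
    by_cases h : a = b
    · subst h
      simp [SExp.ofBool]
    · simp only [List.mem_cons, h, false_or] at ha
      simpa [SExp.ofBool, h, switchE] using ih ha

/-- The state after reading a word from right to left. -/
def runWord (env : List SExp) (s : SExp) (w : List Symbol) : SExp :=
  w.foldr (fun a s => (branchE a).val (s :: .leaf (some a) :: env)) s

theorem toList_ofWord (w : List Symbol) :
    (ofWord w).toList = (w.map fun a => SExp.leaf (some a)).reverse := by
  have h : ∀ x : SExp, (w.foldl (fun x a => SExp.cons (.leaf (some a)) x) x).toList =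
      (w.map fun a => SExp.leaf (some a)).reverse ++ x.toList := by
    induction w with
    | nil => simp
    | cons a w ih => intro x; simp [ih, SExp.toList]
  simp [ofWord, h, SExp.toList]

/-- The list of symbols is the reversed word, so folding over it from the left is folding over the
word from the right. -/
theorem val_loopE (w : List Symbol) :
    loopE.val [ofWord w] =
      runWord [ofWord w] (mkState SExp.nil SExp.nil SExp.nil SExp.nil SExp.nil) w := by
  simp only [loopE, Expr.val, List.getD_cons_zero, toList_ofWord, List.foldl_reverse,
    List.foldr_map, runWord]
  congr 1
  funext a s
  exact val_switchE (by simp) s _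

/-! ### Correctness -/

/-- The numeral of a variable. -/
def numeral (x : ℕ) : SExp :=
  (Computability.encodeNat x).foldr (fun b y => .cons (.leaf (some (.digit b))) y) SExp.nil

theorem numeral_inj {x y : ℕ} : numeral x = numeral y ↔ x = y := by
  refine ⟨fun h => ?_, fun h => by rw [h]⟩
  have key : ∀ a b : List Bool,
      a.foldr (fun b y => SExp.cons (.leaf (some (.digit b))) y) SExp.nil =
        b.foldr (fun b y => SExp.cons (.leaf (some (.digit b))) y) SExp.nil → a = b := by
    intro a
    induction a with
    | nil => intro b; cases b <;> simp
    | cons c a ih =>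
      intro b
      cases b with
      | nil => simp
      | cons d b =>
        intro h
        simp only [List.foldr_cons, SExp.cons.injEq, SExp.leaf.injEq, Option.some.injEq,
          Symbol.digit.injEq] at h
        rw [h.1, ih b h.2]
  rw [← Computability.decode_encodeNat x, key _ _ h, Computability.decode_encodeNat]

open Classical in
/-- The assignment of a row. -/
noncomputable def assignment (r : SExp) (x : ℕ) : Bool := numeral x ∈ r.toList

/-- The team of a list of rows. -/
def teamOf (S : SExp) : Set (ℕ → Bool) := {t | ∃ r ∈ S.toList, assignment r = t}

theorem assignment_eq_true {r : SExp} {x : ℕ} : assignment r x = true ↔ numeral x ∈ r.toList := by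
  simp [assignment]

theorem assignment_eq_false {r : SExp} {x : ℕ} :
    assignment r x = false ↔ numeral x ∉ r.toList := by
  simp [assignment]

theorem assignment_eq_iff {r r' : SExp} {x : ℕ} :
    assignment r x = assignment r' x ↔ (numeral x ∈ r.toList ↔ numeral x ∈ r'.toList) := by
  rw [Bool.eq_iff_iff, assignment_eq_true, assignment_eq_true]

/-- Satisfaction is inherited by subteams. -/
theorem sat_mono {φ : Formula} {S T : Set (ℕ → Bool)} (h : φ.Sat T) (hST : S ⊆ T) : φ.Sat S := by
  induction φ generalizing S T with
  | top => trivial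
  | bot => exact h
  | var x => exact fun t ht => h t (hST ht)
  | negVar x => exact fun t ht => h t (hST ht)
  | or φ ψ hφ hψ =>
    obtain ⟨T₁, T₂, rfl, h₁, h₂⟩ := h
    exact ⟨T₁ ∩ S, T₂ ∩ S, by rw [← Set.union_inter_distrib_right, Set.inter_eq_right.2 hST],
      hφ h₁ Set.inter_subset_left, hψ h₂ Set.inter_subset_left⟩
  | and φ ψ hφ hψ => exact ⟨hφ h.1 hST, hψ h.2 hST⟩
  | dep P Q => exact fun t ht t' ht' => h t (hST ht) t' (hST ht')
  | negDep P Q => exact Set.subset_eq_empty hST h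

/-- `U` lists subteams of `R` and represents all of them. -/
structure IsPowerset (R U : SExp) : Prop where
  subset : ∀ S ∈ U.toList, S.toList ⊆ R.toList
  exists_mem : ∀ p : SExp → Prop, ∃ S ∈ U.toList, ∀ r, r ∈ S.toList ↔ r ∈ R.toList ∧ p r

/-- Induction on the rows from the right: a new row is put in front of the sublist found for the
earlier rows exactly if `p` holds for it. -/
theorem isPowerset_powerset (R : SExp) : IsPowerset R R.powerset := by
  have h₁ : ∀ L : List SExp, ∀ S ∈ (L.foldl (fun (U r : SExp) => U.toList.foldl
      (fun acc S => SExp.cons (.cons r S) acc) U) (.cons SExp.nil SExp.nil)).toList,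
      S.toList ⊆ L := by
    intro L
    induction L using List.reverseRecOn with
    | nil => simp [SExp.toList]
    | append_singleton L r ih =>
      intro S hS
      simp only [List.foldl_append, List.foldl_cons, List.foldl_nil, SExp.toList_foldl_cons,
        List.mem_append, List.mem_reverse, List.mem_map] at hS
      rcases hS with ⟨S, hS, rfl⟩ | hS
      · have := ih S hS
        simp only [SExp.toList, List.cons_subset, List.mem_append, List.mem_singleton, or_true,
          true_and]
        exact List.Subset.trans this (by simp)
      · exact List.Subset.trans (ih S hS) (by simp)
  have h₂ : ∀ (L : List SExp) (p : SExp → Prop), ∃ S ∈ (L.foldl (fun (U r : SExp) => U.toList.foldl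
      (fun acc S => SExp.cons (.cons r S) acc) U) (.cons SExp.nil SExp.nil)).toList,
      ∀ r, r ∈ S.toList ↔ r ∈ L ∧ p r := by
    intro L p
    induction L using List.reverseRecOn with
    | nil => simp [SExp.toList]
    | append_singleton L r ih =>
      obtain ⟨S, hS, h⟩ := ih
      simp only [List.foldl_append, List.foldl_cons, List.foldl_nil, SExp.toList_foldl_cons,
        List.mem_append, List.mem_reverse, List.mem_map]
      by_cases hr : p r
      · refine ⟨.cons r S, Or.inl ⟨S, hS, rfl⟩, fun r' => ?_⟩
        simp only [SExp.toList, List.mem_cons, h, List.not_mem_nil, or_false]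
        constructor
        · rintro (rfl | h) <;> tauto
        · rintro ⟨h | rfl, h'⟩ <;> tauto
      · refine ⟨S, Or.inr hS, fun r' => ?_⟩
        rw [h]
        simp only [List.mem_singleton]
        constructor
        · tauto
        · rintro ⟨h | rfl, h'⟩ <;> tauto
  exact ⟨h₁ _, h₂ _⟩

/-- `t` lists the members of `U` which satisfy a formula. -/
def IsTable (U t : SExp) (φ : Formula) : Prop :=
  ∀ S, S ∈ t.toList ↔ S ∈ U.toList ∧ φ.Sat (teamOf S)

/-- Given `A` and `B` covering `S`, the intersections with `S` form a split of `S`, and they still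
satisfy the disjuncts by downward closure. Conversely, both parts of a split are represented by
members of `U`. -/
theorem isTable_or {R U t u : SExp} {φ ψ : Formula} (hU : IsPowerset R U) (ht : IsTable U t φ)
    (hu : IsTable U u ψ) :
    IsTable U (U.filter fun S => ∃ A ∈ t.toList, ∃ B ∈ u.toList, ∀ r ∈ S.toList,
      (∃ r' ∈ A.toList, r' = r) ∨ ∃ r' ∈ B.toList, r' = r) (.or φ ψ) := by
  intro S
  simp only [SExp.mem_filter, exists_eq_right]
  refine and_congr_right fun hS => ⟨?_, ?_⟩
  · rintro ⟨A, hA, B, hB, h⟩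
    refine ⟨teamOf S ∩ teamOf A, teamOf S ∩ teamOf B, ?_,
      sat_mono ((ht A).1 hA).2 Set.inter_subset_right,
      sat_mono ((hu B).1 hB).2 Set.inter_subset_right⟩
    rw [← Set.inter_union_distrib_left, Set.inter_eq_left]
    rintro _ ⟨r, hr, rfl⟩
    exact (h r hr).imp (fun h => ⟨r, h, rfl⟩) fun h => ⟨r, h, rfl⟩
  · rintro ⟨T₁, T₂, hT, h₁, h₂⟩
    -- Nothing prevents different rows from having the same assignment. So `A` takes all rows of `R`
    -- whose assignment lies in `T'`, which makes it contain the given row and not just one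
    -- equivalent to it.
    have key : ∀ T' ⊆ teamOf S, ∃ A ∈ U.toList, teamOf A = T' ∧
        ∀ r ∈ S.toList, assignment r ∈ T' → r ∈ A.toList := by
      intro T' hT'
      obtain ⟨A, hA, h⟩ := hU.exists_mem fun r => assignment r ∈ T'
      refine ⟨A, hA, ?_, fun r hr hrT => (h r).2 ⟨hU.subset S hS hr, hrT⟩⟩
      ext t
      constructor
      · rintro ⟨r, hr, rfl⟩
        exact ((h r).1 hr).2
      · intro ht
        obtain ⟨r, hr, rfl⟩ := hT' ht
        exact ⟨r, (h r).2 ⟨hU.subset S hS hr, ht⟩, rfl⟩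
    obtain ⟨A, hA, rfl, hA'⟩ := key T₁ (hT ▸ Set.subset_union_left)
    obtain ⟨B, hB, rfl, hB'⟩ := key T₂ (hT ▸ Set.subset_union_right)
    refine ⟨A, (ht A).2 ⟨hA, h₁⟩, B, (hu B).2 ⟨hB, h₂⟩, fun r hr => ?_⟩
    have : assignment r ∈ teamOf A ∪ teamOf B := hT ▸ ⟨r, hr, rfl⟩
    exact this.imp (hA' r hr) (hB' r hr)

theorem isTable_and {U t u : SExp} {φ ψ : Formula} (ht : IsTable U t φ) (hu : IsTable U u ψ) :
    IsTable U (t.filter fun S => ∃ A ∈ u.toList, A = S) (.and φ ψ) := by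
  intro S
  simp only [SExp.mem_filter, exists_eq_right, ht S, hu S, Formula.Sat]
  tauto

theorem isTable_var (U : SExp) (x : ℕ) :
    IsTable U (U.filter fun S => ∀ r ∈ S.toList, ∃ y ∈ r.toList, y = numeral x) (.var x) := by
  intro S
  simp [SExp.mem_filter, Formula.Sat, teamOf, assignment_eq_true]

theorem isTable_negVar (U : SExp) (x : ℕ) :
    IsTable U (U.filter fun S => ∀ r ∈ S.toList, ¬∃ y ∈ r.toList, y = numeral x) (.negVar x) := by
  intro S
  simp [SExp.mem_filter, Formula.Sat, teamOf, assignment_eq_false]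

theorem isTable_negDep (U : SExp) (P Q : Finset ℕ) :
    IsTable U (U.filter fun S => ∀ r ∈ S.toList, False) (.negDep P Q) := by
  intro S
  simp [SExp.mem_filter, Formula.Sat, teamOf, Set.eq_empty_iff_forall_notMem]

/-- The implication defining the atom is tested as a disjunction: the two rows differ somewhere on
`P`, or they agree on all of `Q`. Agreement on a variable is equality of two membership tests, as a
row lists its true variables. -/
theorem isTable_dep (U : SExp) {P Q : Finset ℕ} {c p : SExp}
    (hc : ∀ y, y ∈ c.toList ↔ ∃ x ∈ P, y = numeral x)
    (hp : ∀ y, y ∈ p.toList ↔ ∃ x ∈ Q, y = numeral x) :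
    IsTable U (U.filter fun S => ∀ r ∈ S.toList, ∀ r' ∈ S.toList,
      (∃ y ∈ c.toList, ¬((∃ z ∈ r'.toList, z = y) ↔ ∃ z ∈ r.toList, z = y)) ∨
        ∀ y ∈ p.toList, (∃ z ∈ r'.toList, z = y) ↔ ∃ z ∈ r.toList, z = y) (.dep P Q) := by
  intro S
  simp only [SExp.mem_filter, exists_eq_right, Formula.Sat, teamOf, Set.mem_ofPred_eq,
    forall_exists_index, and_imp, forall_apply_eq_imp_iff₂, assignment_eq_iff, hc, hp]
  refine and_congr_right fun _ => forall₂_congr fun r _ => forall₂_congr fun r' _ => ?_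
  constructor
  · rintro (⟨y, ⟨x, hx, rfl⟩, h⟩ | h) h'
    · exact absurd (h' x hx).symm h
    · exact fun q hq => (h _ q hq rfl).symm
  · intro h
    by_cases h' : ∀ p ∈ P, numeral p ∈ r.toList ↔ numeral p ∈ r'.toList
    · exact Or.inr fun y q hq hy => hy ▸ (h h' q hq).symm
    · push Not at h'
      obtain ⟨x, hx, h'⟩ := h'
      refine Or.inl ⟨_, ⟨x, hx, rfl⟩, ?_⟩
      tauto

end StackProgram

/-! ### Reading an encoded instance from right to left. -/

namespace StackProgram

open PDLogic Turing Function

section run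
variable (env : List SExp) (R U c p st : SExp)

theorem runWord_append (s : SExp) (v w : List Symbol) :
    runWord env s (v ++ w) = runWord env (runWord env s w) v := List.foldr_append

theorem runWord_cons (s : SExp) (a : Symbol) (w : List Symbol) :
    runWord env s (a :: w) =
      (branchE a).val (runWord env s w :: .leaf (some a) :: env) := rfl

/-- Read from the right, the end marker comes first and opens an empty numeral; the digits are then
put in front of it, which restores their order. -/
theorem runWord_encodeVar (x : ℕ) :
    runWord env (mkState R U c p st) (encodeVar x) =
      mkState R U (.cons (numeral x) c) p st := by
  rw [encodeVar, runWord_append]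
  have h : runWord env (mkState R U c p st) [Symbol.endNumber] =
      mkState R U (.cons SExp.nil c) p st := rfl
  rw [h, numeral]
  induction Computability.encodeNat x with
  | nil => rfl
  | cons b l ih =>
    rw [List.map_cons, runWord_cons, ih]
    rfl

theorem runWord_flatMap_encodeVar (L : List ℕ) :
    runWord env (mkState R U c p st) (L.flatMap encodeVar) =
      mkState R U (L.foldr (fun x c => .cons (numeral x) c) c) p st := by
  induction L with
  | nil => rfl
  | cons x L ih => rw [List.flatMap_cons, runWord_append, ih, runWord_encodeVar, List.foldr_cons]

theorem mem_foldr_numeral (L : List ℕ) (y : SExp) :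
    y ∈ (L.foldr (fun x c => SExp.cons (numeral x) c) c).toList ↔
      (∃ x ∈ L, y = numeral x) ∨ y ∈ c.toList := by
  induction L with
  | nil => simp
  | cons x L ih => simp [SExp.toList, ih, or_assoc]

/-- The end marker, met first, opens a new current list and shifts the old one to the second place.
After both sets of a dependence atom, `P` is therefore the current list and `Q` the previous one. -/
theorem runWord_encodeVarSet (X : Finset ℕ) : ∃ d : SExp,
    (∀ y, y ∈ d.toList ↔ ∃ x ∈ X, y = numeral x) ∧
      runWord env (mkState R U c p st) (encodeVarSet X) = mkState R U d c st := by
  refine ⟨(X.sort (· ≤ ·)).foldr (fun x c => .cons (numeral x) c) SExp.nil, fun y => ?_, ?_⟩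
  · simp [mem_foldr_numeral, SExp.toList]
  · rw [encodeVarSet, runWord_append]
    exact runWord_flatMap_encodeVar env R U SExp.nil c st _

variable {R U} in
/-- Reading a formula from right to left pushes its table. -/
theorem runWord_formula (hU : IsPowerset R U) (φ : Formula) : ∀ st, ∃ t, IsTable U t φ ∧
    runWord env (mkState R U SExp.nil SExp.nil st) φ.encode =
      mkState R U SExp.nil SExp.nil (.cons t st) := by
  induction φ with
  | top => intro st; exact ⟨U, fun S => by simp [Formula.Sat], rfl⟩
  | bot => intro st; exact ⟨SExp.nil, fun S => by simp [Formula.Sat, SExp.toList], rfl⟩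
  | var x =>
    intro st
    refine ⟨_, isTable_var U x, ?_⟩
    rw [Formula.encode, runWord_cons, runWord_encodeVar]
    -- The other components of the state agree by computation. The value of the table is found by
    -- following the syntax of its term, which mirrors the filter in the statement about tables.
    exact congrArg (fun t => mkState R U SExp.nil SExp.nil (.cons t st)) <|
      Expr.val_filter fun _ S => Expr.val_all fun _ r => Expr.val_any fun _ y => Expr.val_eq _ _
  | negVar x =>
    intro st
    refine ⟨_, isTable_negVar U x, ?_⟩
    rw [Formula.encode, runWord_cons, runWord_encodeVar]
    exact congrArg (fun t => mkState R U SExp.nil SExp.nil (.cons t st)) <|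
      Expr.val_filter fun _ S => Expr.val_all fun _ r =>
        Expr.val_not <| Expr.val_any fun _ y => Expr.val_eq _ _
  | or φ ψ hφ hψ =>
    intro st
    -- The right disjunct is read first, so its table ends up below that of the left one.
    obtain ⟨u, hu, h₁⟩ := hψ st
    obtain ⟨t, ht, h₂⟩ := hφ (.cons u st)
    refine ⟨_, isTable_or hU ht hu, ?_⟩
    rw [Formula.encode, runWord_cons, runWord_append, h₁, h₂]
    exact congrArg (fun t => mkState R U SExp.nil SExp.nil (.cons t st)) <|
      Expr.val_filter fun _ S => Expr.val_any fun _ A => Expr.val_any fun _ B =>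
        Expr.val_all fun _ r => Expr.val_or (Expr.val_any fun _ y => Expr.val_eq _ _)
          (Expr.val_any fun _ y => Expr.val_eq _ _)
  | and φ ψ hφ hψ =>
    intro st
    obtain ⟨u, hu, h₁⟩ := hψ st
    obtain ⟨t, ht, h₂⟩ := hφ (.cons u st)
    refine ⟨_, isTable_and ht hu, ?_⟩
    rw [Formula.encode, runWord_cons, runWord_append, h₁, h₂]
    exact congrArg (fun t => mkState R U SExp.nil SExp.nil (.cons t st)) <|
      Expr.val_filter fun _ S => Expr.val_any fun _ A => Expr.val_eq _ _
  | dep P Q =>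
    intro st
    obtain ⟨q, hq, h₁⟩ := runWord_encodeVarSet env R U SExp.nil SExp.nil st Q
    obtain ⟨p, hp, h₂⟩ := runWord_encodeVarSet env R U q SExp.nil st P
    refine ⟨_, isTable_dep U hp hq, ?_⟩
    rw [Formula.encode, runWord_cons, runWord_append, h₁, h₂]
    exact congrArg (fun t => mkState R U SExp.nil SExp.nil (.cons t st)) <|
      Expr.val_filter fun _ S => Expr.val_all fun _ r => Expr.val_all fun _ r' =>
        Expr.val_or
          (Expr.val_any fun _ y => Expr.val_not <| Expr.val_eq_iff
            (Expr.val_any fun _ z => Expr.val_eq _ _) (Expr.val_any fun _ z => Expr.val_eq _ _))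
          (Expr.val_all fun _ y => Expr.val_eq_iff
            (Expr.val_any fun _ z => Expr.val_eq _ _) (Expr.val_any fun _ z => Expr.val_eq _ _))
  | negDep P Q =>
    intro st
    obtain ⟨q, -, h₁⟩ := runWord_encodeVarSet env R U SExp.nil SExp.nil st Q
    obtain ⟨p, -, h₂⟩ := runWord_encodeVarSet env R U q SExp.nil st P
    refine ⟨_, isTable_negDep U P Q, ?_⟩
    rw [Formula.encode, runWord_cons, runWord_append, h₁, h₂]
    exact congrArg (fun t => mkState R U SExp.nil SExp.nil (.cons t st)) <|
      Expr.val_filter fun _ S => Expr.val_all fun _ r => (SExp.ofProp_false _root_.id).symm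

end run

/-- In each pair the value precedes the variable, hence is read when the numeral is complete: `true`
moves the numeral to the open row, `false` discards it. Variables outside `V` are absent from the
row, in accordance with the default `false` of `extend`. -/
theorem runWord_encodeAssignment (env : List SExp) (R U st : SExp) {V : Finset ℕ}
    (s : {x // x ∈ V} → Bool) : ∃ r, assignment r = MCInstance.extend s ∧
      runWord env (mkState R U SExp.nil SExp.nil st) (encodeAssignment s) =
        mkState (.cons r R) U SExp.nil SExp.nil st := by
  have key : ∀ L : List ℕ, ∃ r : SExp,
      (∀ y, y ∈ r.toList ↔ ∃ x ∈ L, MCInstance.extend s x = true ∧ y = numeral x) ∧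
      runWord env (mkState (.cons SExp.nil R) U SExp.nil SExp.nil st)
        (L.flatMap fun x => Symbol.value (MCInstance.extend s x) :: encodeVar x) =
        mkState (.cons r R) U SExp.nil SExp.nil st := by
    intro L
    induction L with
    | nil => exact ⟨SExp.nil, by simp [SExp.toList], rfl⟩
    | cons x L ih =>
      obtain ⟨r, hr, h⟩ := ih
      rw [List.flatMap_cons, runWord_append, h, runWord_cons, runWord_encodeVar]
      cases hx : MCInstance.extend s x with
      | true => exact ⟨.cons (numeral x) r, fun y => by simp [SExp.toList, hr, hx], rfl⟩
      | false => exact ⟨r, fun y => by simp [hr, hx], rfl⟩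
  obtain ⟨r, hr, h⟩ := key (V.sort (· ≤ ·))
  refine ⟨r, ?_, ?_⟩
  · funext x
    rw [Bool.eq_iff_iff, assignment_eq_true, hr]
    simp only [Finset.mem_sort, numeral_inj]
    constructor
    · rintro ⟨y, -, hy, rfl⟩
      exact hy
    · intro hx
      refine ⟨x, ?_, hx, rfl⟩
      by_contra hV
      simp [MCInstance.extend, hV] at hx
  · rw [encodeAssignment, runWord_append]
    exact h

theorem runWord_team (env : List SExp) (U st : SExp) {V : Finset ℕ}
    (T : List ({x // x ∈ V} → Bool)) : ∃ R : SExp,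
      teamOf R = {t | ∃ s ∈ T, MCInstance.extend s = t} ∧
      runWord env (mkState SExp.nil U SExp.nil SExp.nil st) (T.flatMap encodeAssignment) =
        mkState R U SExp.nil SExp.nil st := by
  induction T with
  | nil => exact ⟨SExp.nil, by simp [teamOf, SExp.toList], rfl⟩
  | cons s T ih =>
    obtain ⟨R, hR, h⟩ := ih
    obtain ⟨r, hr, h'⟩ := runWord_encodeAssignment env R U st s
    refine ⟨.cons r R, ?_, ?_⟩
    · ext t
      have := Set.ext_iff.1 hR t
      simp only [teamOf, Set.mem_ofPred_eq] at this
      simp [teamOf, SExp.toList, hr, this]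
    · rw [List.flatMap_cons, runWord_append, h, h']

/-- The model checking program is correct. -/
theorem val_programE (I : MCInstance) :
    programE.val [ofWord I.encode] = SExp.ofProp I.Holds := by
  set env := [ofWord I.encode] with henv
  obtain ⟨R, hR, h₁⟩ := runWord_team env SExp.nil SExp.nil I.team
  obtain ⟨t, ht, h₂⟩ := runWord_formula env (isPowerset_powerset R) I.formula SExp.nil
  -- When the end marker of the formula is reached, all rows have been read, so the list of subteams
  -- is complete before the first subformula is evaluated.
  have h₃ : loopE.val env =
      mkState R R.powerset SExp.nil SExp.nil (.cons t SExp.nil) := by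
    rw [henv, val_loopE, ← henv, MCInstance.encode, runWord_append, runWord_cons, h₁]
    exact h₂
  have h₄ : programE.val env = SExp.ofProp (∃ A ∈ t.toList, ∀ r ∈ R.toList,
      ∃ y ∈ A.toList, y = r) := by
    rw [programE, Expr.val, h₃]
    exact Expr.val_any fun _ A => Expr.val_all fun _ r => Expr.val_any fun _ y =>
      Expr.val_eq _ _
  rw [h₄]
  refine SExp.ofProp_congr ?_
  rw [MCInstance.Holds, ← hR]
  simp only [exists_eq_right]
  constructor
  · rintro ⟨A, hA, h⟩
    -- A member of the table containing all rows is enough, by downward closure.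
    refine sat_mono ((ht A).1 hA).2 ?_
    rintro _ ⟨r, hr, rfl⟩
    exact ⟨r, h r hr, rfl⟩
  · intro h
    -- The trivial property selects a member of the powerset with the same rows as `R`.
    obtain ⟨S, hS, h'⟩ := (isPowerset_powerset R).exists_mem fun _ => True
    have h' : teamOf S = teamOf R := by
      ext
      simp [teamOf, h']
    exact ⟨S, (ht S).2 ⟨hS, h' ▸ h⟩, fun r hr => by simp_all⟩

end StackProgram

/-! ### Bounds on the sizes of intermediate values -/

namespace StackProgram

open PDLogic Turing Function

namespace SExp

/-- The contribution of a list of members to the size of a list. -/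
def listSize (L : List SExp) : ℕ := (L.map fun x => x.size + 1).sum

theorem listSize_nil : listSize [] = 0 := rfl

theorem listSize_cons (x : SExp) (L : List SExp) :
    listSize (x :: L) = x.size + 1 + listSize L := by
  simp [listSize]

theorem listSize_append (L L' : List SExp) :
    listSize (L ++ L') = listSize L + listSize L' := by
  simp [listSize]

theorem listSize_reverse (L : List SExp) : listSize L.reverse = listSize L := by
  simp [listSize]

theorem size_eq (x : SExp) : x.size = listSize x.toList + 1 := by
  induction x with
  | leaf a => rfl
  | cons x y hx hy => rw [toList, listSize_cons, size, hy]; omega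

theorem listSize_le {L : List SExp} {A : ℕ} (h : ∀ x ∈ L, x.size ≤ A) :
    listSize L ≤ L.length * (A + 1) := by
  induction L with
  | nil => simp [listSize]
  | cons x L ih =>
    simp only [List.mem_cons, forall_eq_or_imp] at h
    rw [listSize_cons, List.length_cons, Nat.add_mul]
    have := ih h.2
    omega

/-- The list of all sublists of a list of S-expressions. -/
def sublists (L : List SExp) : SExp :=
  L.foldl (fun (U r : SExp) => U.toList.foldl (fun acc S => .cons (.cons r S) acc) U)
    (.cons nil nil)

theorem sublists_append_singleton (L : List SExp) (r : SExp) :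
    sublists (L ++ [r]) =
      (sublists L).toList.foldl (fun acc S => .cons (.cons r S) acc) (sublists L) := by
  simp [sublists]

theorem toList_sublists_append_singleton (L : List SExp) (r : SExp) :
    (sublists (L ++ [r])).toList =
      ((sublists L).toList.map (SExp.cons r)).reverse ++ (sublists L).toList := by
  rw [sublists_append_singleton, toList_foldl_cons]

theorem length_sublists (L : List SExp) : (sublists L).toList.length = 2 ^ L.length := by
  induction L using List.reverseRecOn with
  | nil => rfl
  | append_singleton L r ih =>
    rw [toList_sublists_append_singleton]
    simp [ih, pow_succ]
    omega

theorem size_le_of_mem_sublists (L : List SExp) :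
    ∀ S ∈ (sublists L).toList, S.size ≤ listSize L + 1 := by
  induction L using List.reverseRecOn with
  | nil => simp [sublists, toList, size]
  | append_singleton L r ih =>
    intro S hS
    rw [toList_sublists_append_singleton] at hS
    rw [listSize_append, listSize_cons, listSize_nil]
    simp only [List.mem_append, List.mem_reverse, List.mem_map] at hS
    rcases hS with ⟨S, hS, rfl⟩ | hS
    · have := ih S hS
      simp only [size]
      omega
    · have := ih S hS
      omega

theorem size_sublists_le (L : List SExp) :
    (sublists L).size ≤ 2 ^ L.length * (listSize L + 2) + 1 := by
  rw [size_eq, ← length_sublists]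
  exact Nat.add_le_add_right (listSize_le (size_le_of_mem_sublists L)) 1

theorem size_foldl_cons (r : SExp) (L : List SExp) (acc : SExp) :
    (L.foldl (fun acc S => SExp.cons (.cons r S) acc) acc).size =
      listSize (L.map (SExp.cons r)) + acc.size := by
  rw [size_eq, toList_foldl_cons, listSize_append, listSize_reverse, size_eq acc]
  omega

theorem size_hd_add_size_tl_le (x : SExp) : x.hd.size + x.tl.size ≤ x.size + 1 := by
  cases x <;> simp [hd, tl, size]; omega

end SExp

/-! ### Boundedness of terms, filters and powersets. -/

namespace Expr

/-- Whether a term with variables below `n` does not build pairs. -/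
def isPure : Expr → ℕ → Bool
  | var i, n => i < n
  | leaf _, _ => true
  | cons _ _, _ => false
  | hd x, n => x.isPure n
  | tl x, n => x.isPure n
  | ite x y z, n => x.isPure n && y.isPure n && z.isPure n
  | eq x y, n => x.isPure n && y.isPure n
  | bind x b, n => x.isPure n && b.isPure (n + 1)
  | fold l i b, n => l.isPure n && i.isPure n && b.isPure (n + 2)

/-- Without `cons` the only condition left in `Bdd` is that variables are in scope, and this depends
only on the length of the environment. -/
theorem bdd_of_isPure {N : ℕ} (x : Expr) :
    ∀ env, x.isPure env.length = true → x.Bdd N env := by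
  induction x with
  | var i => intro env h; simpa [isPure, Bdd] using h
  | leaf a => intro env h; trivial
  | cons x y hx hy => intro env h; simp [isPure] at h
  | hd x hx => intro env h; exact hx env h
  | tl x hx => intro env h; exact hx env h
  | ite x y z hx hy hz =>
    intro env h
    simp only [isPure, Bool.and_eq_true] at h
    exact ⟨hx env h.1.1, fun _ => hy env h.1.2, fun _ => hz env h.2⟩
  | eq x y hx hy =>
    intro env h
    simp only [isPure, Bool.and_eq_true] at h
    exact ⟨hx env h.1, hy env h.2⟩
  | bind x b hx hb =>
    intro env h
    simp only [isPure, Bool.and_eq_true] at h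
    exact ⟨hx env h.1, hb _ h.2⟩
  | fold l i b hl hi hb =>
    intro env h
    simp only [isPure, Bool.and_eq_true] at h
    exact ⟨hl env h.1.1, hi env h.1.2, fun p x s _ => hb _ h.2⟩

/-- Whatever the test does, each member enters the result at most once. -/
theorem size_foldl_filter_le {b : Expr} {env : List SExp} (L : List SExp) :
    (L.foldl (fun acc x => (ite b (.cons (.var 1) (.var 0)) (.var 0)).val (acc :: x :: env))
      SExp.nil).size ≤ SExp.listSize L + 1 := by
  induction L using List.reverseRecOn with
  | nil => simp [SExp.size]
  | append_singleton L x ih =>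
    rw [List.foldl_append, SExp.listSize_append, SExp.listSize_cons, SExp.listSize_nil,
      List.foldl_cons, List.foldl_nil]
    rw [val]
    split
    · exact ih.trans (by omega)
    · exact Nat.le_trans (m := x.size + _ + 1) le_rfl
        (Nat.add_le_add_right (Nat.add_le_add_left ih _) _ |>.trans (by omega))

theorem size_val_filter_le (l b : Expr) (env : List SExp) :
    ((filter l b).val env).size ≤ (l.val env).size := by
  rw [SExp.size_eq (l.val env)]
  exact size_foldl_filter_le _

theorem bdd_filter {N : ℕ} {l b : Expr} {env : List SExp} (hl : l.isPure env.length = true)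
    (hb : b.isPure (env.length + 2) = true) (hN : (l.val env).size ≤ N) :
    (filter l b).Bdd N env := by
  refine ⟨bdd_of_isPure l env hl, trivial, fun p x s h => ⟨bdd_of_isPure b _ hb, fun _ => ?_,
    fun _ => by simp [Bdd]⟩⟩
  refine ⟨by simp [Bdd], by simp [Bdd], ?_⟩
  refine (Nat.add_le_add_right (Nat.add_le_add_left (size_foldl_filter_le p) x.size) 1).trans ?_
  rw [SExp.size_eq, h, SExp.listSize_append, SExp.listSize_cons] at hN
  omega

theorem bdd_powerset {N : ℕ} {l : Expr} {env : List SExp} (hl : l.isPure env.length = true)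
    (hN : 2 ^ (l.val env).toList.length * ((l.val env).size + 1) + 1 ≤ N) :
    (powerset l).Bdd N env := by
  have hN' : 3 ≤ N := by
    have := (l.val env).one_le_size
    have : 1 * 2 ≤ 2 ^ (l.val env).toList.length * ((l.val env).size + 1) :=
      Nat.mul_le_mul Nat.one_le_two_pow (by omega)
    omega
  refine ⟨bdd_of_isPure l env hl, ⟨trivial, trivial, by simp [val, SExp.size]; omega⟩,
    fun p r s h => ⟨by simp [Bdd], by simp [Bdd], fun p' S s' h' => ?_⟩⟩
  -- The inner fold only ever enlarges its accumulator and ends with the sublists of `p ++ [r]`. So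
  -- bounding this final value bounds every intermediate value.
  have h₁ : (SExp.sublists (p ++ [r])).size ≤ N := by
    refine (SExp.size_sublists_le _).trans
      (le_trans (Nat.add_le_add_right (Nat.mul_le_mul ?_ ?_) 1) hN)
    · refine Nat.pow_le_pow_right (by omega) ?_
      rw [h]
      simp
    · rw [SExp.size_eq, h]
      simp only [SExp.listSize_append, SExp.listSize_cons, SExp.listSize_nil]
      omega
  change (SExp.sublists p).toList = p' ++ S :: s' at h'
  rw [SExp.sublists_append_singleton, SExp.size_foldl_cons, h', List.map_append, List.map_cons,
    SExp.listSize_append, SExp.listSize_cons] at h₁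
  have h₂ := SExp.size_foldl_cons r p' (SExp.sublists p)
  simp only [SExp.size] at h₁
  refine ⟨⟨by simp [Bdd], by simp [Bdd], ?_⟩, by simp [Bdd], ?_⟩
  · change r.size + S.size + 1 ≤ N
    omega
  · change (r.size + S.size + 1) +
      (p'.foldl (fun acc S => SExp.cons (.cons r S) acc) (SExp.sublists p)).size + 1 ≤ N
    omega

theorem size_val_powerset_le (l : Expr) (env : List SExp) :
    ((powerset l).val env).size ≤ 2 ^ (l.val env).toList.length * ((l.val env).size + 1) + 1 := by
  rw [SExp.size_eq (l.val env)]
  exact SExp.size_sublists_le _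

end Expr

/-! ### The size invariant of the main loop. -/

/-- The bound on the size of a table, for words of length `n` with `m` rows. -/
def tableBound (n m : ℕ) : ℕ := 2 ^ (m + 1) * (4 * n + 4) + 1

/-- The bound on the sizes of all values, for words of length `n` with `m` rows. -/
def sizeBound (n m : ℕ) : ℕ := 4 * n + 8 + (n + 1) * (tableBound n m + 1)

/-- The invariant of the main loop after reading `k` symbols, `m` of which are ends of rows. -/
def IsBoundedState (P k m : ℕ) (s : SExp) : Prop :=
  ∃ R U c p st, s = mkState R U c p st ∧ R.size + c.size + p.size ≤ 4 * k + 3 ∧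
    R.toList.length ≤ m + 1 ∧ U.size ≤ P ∧ st.size ≤ k * (P + 1) + 1 ∧
    ∀ t ∈ st.toList, t.size ≤ P

theorem SExp.mem_of_mem_toList_tl {x y : SExp} (h : y ∈ x.tl.toList) : y ∈ x.toList := by
  cases x with
  | leaf a => exact h
  | cons x x' => exact List.mem_cons_of_mem _ h

theorem SExp.size_hd_le_of_forall {x : SExp} {P : ℕ} (hP : 1 ≤ P) (h : ∀ y ∈ x.toList, y.size ≤ P) :
    x.hd.size ≤ P := by
  cases x with
  | leaf a => exact hP
  | cons x x' => exact h x (by simp [SExp.toList])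

theorem isBoundedState_push {P k m : ℕ} {R U st t : SExp} (hR : R.size + 2 ≤ 4 * (k + 1) + 3)
    (hl : R.toList.length ≤ m + 1) (hU : U.size ≤ P) (hst : st.size ≤ k * (P + 1) + 1)
    (h : ∀ t ∈ st.toList, t.size ≤ P) (ht : t.size ≤ P) :
    IsBoundedState P (k + 1) m (mkState R U SExp.nil SExp.nil (.cons t st)) := by
  refine ⟨R, U, SExp.nil, SExp.nil, .cons t st, rfl, hR, hl, hU, ?_, ?_⟩
  · rw [SExp.size, Nat.succ_mul]
    omega
  · simpa [SExp.toList] using ⟨ht, h⟩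

/-- The rows and the two lists of variables are bounded jointly because a numeral migrates from the
current list to a row; one symbol adds at most 4 to their total, which starts at 3 for three empty
lists. Filtered tables never outgrow the list they are filtered from, so only the powerset needs
`hP`. Arbitrary words are allowed, not just encodings. -/
theorem IsBoundedState.step {P k m : ℕ} {s : SExp} (h : IsBoundedState P k m s)
    (hP : 2 ^ (m + 1) * (4 * k + 4) + 1 ≤ P) (a : Symbol) (env : List SExp) :
    IsBoundedState P (k + 1) (m + [a].count Symbol.endRow)
      ((branchE a).val (s :: .leaf (some a) :: env)) := by
  obtain ⟨R, U, c, p, st, rfl, h₁, h₂, h₃, h₄, h₅⟩ := h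
  have hR := R.one_le_size
  have hc := c.one_le_size
  have hp := p.one_le_size
  have hU := U.one_le_size
  have hP₁ : 1 ≤ P := hU.trans h₃
  have h₆ : k * (P + 1) + 1 ≤ (k + 1) * (P + 1) + 1 := by rw [Nat.succ_mul]; omega
  have hk : 0 ≤ k * (P + 1) := Nat.zero_le _
  have hR' : R.size + 2 ≤ 4 * (k + 1) + 3 := by omega
  have htl : st.tl.tl.size ≤ k * (P + 1) + 1 :=
    (SExp.size_tl_le _).trans ((SExp.size_tl_le _).trans h₄)
  have htl' : ∀ t ∈ st.tl.tl.toList, t.size ≤ P := fun t ht =>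
    h₅ t (SExp.mem_of_mem_toList_tl (SExp.mem_of_mem_toList_tl ht))
  have hRhd := SExp.size_hd_add_size_tl_le R
  have hchd := SExp.size_hd_add_size_tl_le c
  cases a with
  | top => exact isBoundedState_push hR' h₂ h₃ h₄ h₅ h₃
  | bot => exact isBoundedState_push hR' h₂ h₃ h₄ h₅ hP₁
  | var => exact isBoundedState_push hR' h₂ h₃ h₄ h₅ ((Expr.size_val_filter_le _ _ _).trans h₃)
  | negVar => exact isBoundedState_push hR' h₂ h₃ h₄ h₅ ((Expr.size_val_filter_le _ _ _).trans h₃)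
  | or => exact isBoundedState_push hR' h₂ h₃ htl htl' ((Expr.size_val_filter_le _ _ _).trans h₃)
  | and => exact isBoundedState_push hR' h₂ h₃ htl htl' ((Expr.size_val_filter_le _ _ _).trans
      (SExp.size_hd_le_of_forall hP₁ h₅))
  | dep => exact isBoundedState_push hR' h₂ h₃ h₄ h₅ ((Expr.size_val_filter_le _ _ _).trans h₃)
  | negDep => exact isBoundedState_push hR' h₂ h₃ h₄ h₅ ((Expr.size_val_filter_le _ _ _).trans h₃)
  | digit b =>
    refine ⟨R, U, .cons (.cons (.leaf (some (.digit b))) c.hd) c.tl, p, st, rfl, ?_, h₂, h₃,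
      h₄.trans h₆, h₅⟩
    simp only [SExp.size]
    omega
  | endNumber =>
    refine ⟨R, U, .cons SExp.nil c, p, st, rfl, ?_, h₂, h₃, h₄.trans h₆, h₅⟩
    simp only [SExp.size]
    omega
  | endSet =>
    refine ⟨R, U, SExp.nil, c, st, rfl, ?_, h₂, h₃, h₄.trans h₆, h₅⟩
    simp only [SExp.size]
    omega
  | endFormula =>
    refine ⟨R, R.powerset, SExp.nil, SExp.nil, SExp.nil, rfl, hR', h₂, ?_, ?_, ?_⟩
    · refine (Expr.size_val_powerset_le (.var 0) [R]).trans (le_trans ?_ hP)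
      exact Nat.add_le_add_right (Nat.mul_le_mul (Nat.pow_le_pow_right (by omega) h₂)
        (by change R.size + 1 ≤ _; omega)) 1
    · simp only [SExp.size]
      omega
    · simp [SExp.toList]
  | value b =>
    cases b with
    | true =>
      refine ⟨.cons (.cons c.hd R.hd) R.tl, U, SExp.nil, SExp.nil, st, rfl, ?_, ?_, h₃, h₄.trans h₆,
        h₅⟩
      · simp only [SExp.size]
        have := SExp.size_hd_le c
        omega
      -- If no row has been opened yet, this branch creates one without an end marker; hence `m + 1`
      -- rather than `m` rows in the invariant.
      · cases R with
        | leaf r => simp [SExp.toList, SExp.tl]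
        | cons r R => simpa [SExp.toList, SExp.tl] using h₂
    | false => exact ⟨R, U, SExp.nil, SExp.nil, st, rfl, hR', h₂, h₃, h₄.trans h₆, h₅⟩
  | endRow =>
    refine ⟨.cons SExp.nil R, U, SExp.nil, SExp.nil, st, rfl, ?_, ?_, h₃, h₄.trans h₆, h₅⟩
    · simp only [SExp.size]
      omega
    · simpa [SExp.toList] using h₂

theorem isBoundedState_runWord {P n m : ℕ} (hP : 2 ^ (m + 1) * (4 * n + 4) + 1 ≤ P)
    (env : List SExp) : ∀ w : List Symbol, w.length ≤ n → w.count .endRow ≤ m →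
      IsBoundedState P w.length (w.count .endRow)
        (runWord env (mkState SExp.nil SExp.nil SExp.nil SExp.nil SExp.nil) w) := by
  intro w
  induction w with
  | nil =>
    intro _ _
    have : 1 ≤ P := le_trans (by omega) hP
    exact ⟨_, _, _, _, _, rfl, by simp [SExp.size], by simp [SExp.toList], this,
      by simp [SExp.size],
      by simp [SExp.toList]⟩
  | cons a w ih =>
    intro h₁ h₂
    rw [← List.singleton_append, List.count_append, add_comm] at h₂ ⊢
    have h₃ : w.length ≤ n := by simp at h₁; omega
    refine (ih h₃ (by omega)).step (le_trans ?_ hP) a env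
    exact Nat.add_le_add_right (Nat.mul_le_mul (Nat.pow_le_pow_right (by omega) (by omega))
      (by omega)) 1

/-- The stack contributes `n` tables and the list of subteams counts as one more, whence the factor
`n + 1` in `sizeBound`. -/
theorem size_le_of_isBoundedState {n m k m' : ℕ} {s : SExp}
    (h : IsBoundedState (tableBound n m) k m' s) (hk : k ≤ n) : s.size ≤ sizeBound n m := by
  obtain ⟨R, U, c, p, st, rfl, h₁, -, h₃, h₄, -⟩ := h
  have := Nat.mul_le_mul_right (tableBound n m + 1) hk
  simp only [SExp.size, sizeBound, Nat.succ_mul]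
  omega

/-- The inner pairs are parts of the whole state, so a bound on the state bounds them all. -/
theorem bdd_mkE {N : ℕ} {R U c p st : Expr} {env : List SExp} (hR : R.Bdd N env)
    (hU : U.Bdd N env) (hc : c.Bdd N env) (hp : p.Bdd N env) (hst : st.Bdd N env)
    (h : ((mkE R U c p st).val env).size ≤ N) : (mkE R U c p st).Bdd N env := by
  simp only [Expr.val, SExp.size] at h
  simp only [Expr.Bdd, Expr.val, SExp.size]
  refine ⟨hR, ⟨hU, ⟨hc, ⟨hp, hst, ?_⟩, ?_⟩, ?_⟩, ?_⟩ <;> omega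

theorem bdd_branchE {n m k : ℕ} {s x : SExp} {a : Symbol}
    (h : IsBoundedState (tableBound n m) k m s) (hk : k < n)
    (h' : ((branchE a).val [s, .leaf (some a), x]).size ≤ sizeBound n m) :
    (branchE a).Bdd (sizeBound n m) [s, .leaf (some a), x] := by
  have hP : tableBound n m ≤ sizeBound n m := by
    have := Nat.mul_le_mul_right (tableBound n m + 1) (Nat.zero_le n)
    simp only [sizeBound, Nat.succ_mul]
    omega
  obtain ⟨R, U, c, p, st, rfl, h₁, h₂, h₃, h₄, h₅⟩ := h
  have hU : U.size ≤ sizeBound n m := h₃.trans hP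
  have pure : ∀ e : Expr, e.isPure 3 = true → e.Bdd (sizeBound n m)
      [mkState R U c p st, .leaf (some a), x] := fun e he => Expr.bdd_of_isPure e _ he
  have cons : ∀ e₁ e₂ : Expr, e₁.Bdd (sizeBound n m) [mkState R U c p st, .leaf (some a), x] →
      e₂.Bdd (sizeBound n m) [mkState R U c p st, .leaf (some a), x] →
      ((Expr.cons e₁ e₂).val [mkState R U c p st, .leaf (some a), x]).size ≤ sizeBound n m →
      (Expr.cons e₁ e₂).Bdd (sizeBound n m) [mkState R U c p st, .leaf (some a), x] :=
    fun _ _ h₁ h₂ h => ⟨h₁, h₂, h⟩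
  have push : ∀ e st' : Expr,
      e.Bdd (sizeBound n m) [mkState R U c p st, .leaf (some a), x] → st'.isPure 3 = true →
      ((mkE (rowsE 0) (subteamsE 0) nilE nilE (.cons e st')).val
        [mkState R U c p st, .leaf (some a), x]).size ≤ sizeBound n m →
      (mkE (rowsE 0) (subteamsE 0) nilE nilE (.cons e st')).Bdd (sizeBound n m)
        [mkState R U c p st, .leaf (some a), x] := fun e st' he hst h =>
    bdd_mkE (pure _ rfl) (pure _ rfl) (pure _ rfl) (pure _ rfl)
      (cons _ _ he (pure _ hst) (by simp only [Expr.val, SExp.size] at h ⊢; omega)) h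
  cases a with
  | top => exact push _ _ (pure _ rfl) rfl h'
  | bot => exact push _ _ (pure _ rfl) rfl h'
  | var => exact push _ _ (Expr.bdd_filter rfl rfl hU) rfl h'
  | negVar => exact push _ _ (Expr.bdd_filter rfl rfl hU) rfl h'
  | or => exact push _ _ (Expr.bdd_filter rfl rfl hU) rfl h'
  | and =>
    have hP₁ : 1 ≤ tableBound n m := by simp [tableBound]
    exact push _ _ (Expr.bdd_filter rfl rfl ((SExp.size_hd_le_of_forall hP₁ h₅).trans hP)) rfl h'
  | dep => exact push _ _ (Expr.bdd_filter rfl rfl hU) rfl h'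
  | negDep => exact push _ _ (Expr.bdd_filter rfl rfl hU) rfl h'
  | digit b =>
    simp only [branchE, Expr.val, SExp.size] at h'
    refine bdd_mkE (pure _ rfl) (pure _ rfl) (cons _ _ (cons _ _ (pure _ rfl) (pure _ rfl) ?_)
      (pure _ rfl) ?_) (pure _ rfl) (pure _ rfl) ?_ <;>
    · simp only [Expr.val, SExp.size]
      omega
  | endNumber =>
    simp only [branchE, Expr.val, SExp.size] at h'
    refine bdd_mkE (pure _ rfl) (pure _ rfl) (cons _ _ (pure _ rfl) (pure _ rfl) ?_)
      (pure _ rfl) (pure _ rfl) ?_ <;>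
    · simp only [Expr.val, SExp.size]
      omega
  | endSet => exact bdd_mkE (pure _ rfl) (pure _ rfl) (pure _ rfl) (pure _ rfl) (pure _ rfl) h'
  | endFormula =>
    refine bdd_mkE (pure _ rfl) (Expr.bdd_powerset rfl (le_trans ?_ hP)) (pure _ rfl) (pure _ rfl)
      (pure _ rfl) h'
    exact Nat.add_le_add_right (Nat.mul_le_mul (Nat.pow_le_pow_right (by omega) h₂)
      (by
        change R.size + 1 ≤ _
        have := c.one_le_size
        omega)) 1
  | value b =>
    cases b with
    | true =>
      simp only [branchE, Expr.val, SExp.size] at h'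
      refine bdd_mkE (cons _ _ (cons _ _ (pure _ rfl) (pure _ rfl) ?_) (pure _ rfl) ?_) (pure _ rfl)
        (pure _ rfl) (pure _ rfl) (pure _ rfl) ?_ <;>
      · simp only [Expr.val, SExp.size]
        omega
    | false => exact bdd_mkE (pure _ rfl) (pure _ rfl) (pure _ rfl) (pure _ rfl) (pure _ rfl) h'
  | endRow =>
    simp only [branchE, Expr.val, SExp.size] at h'
    refine bdd_mkE (cons _ _ (pure _ rfl) (pure _ rfl) ?_) (pure _ rfl) (pure _ rfl) (pure _ rfl)
      (pure _ rfl) ?_ <;>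
    · simp only [Expr.val, SExp.size]
      omega

/-- Branches of other symbols are not evaluated, so nothing is required of them. -/
theorem bdd_switchE {N : ℕ} {f : Symbol → Expr} (L : List Symbol) {a : Symbol} {s x : SExp}
    (h : (f a).Bdd N [s, .leaf (some a), x]) :
    (switchE f L).Bdd N [s, .leaf (some a), x] := by
  induction L with
  | nil => trivial
  | cons b L ih =>
    refine ⟨Expr.bdd_of_isPure _ _ rfl, fun hb => ?_, fun _ => ih⟩
    obtain rfl : a = b := by
      by_contra hab
      simp [Expr.val, SExp.ofBool, hab] at hb
    exact h

theorem size_ofWord (w : List Symbol) : (ofWord w).size = 2 * w.length + 1 := by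
  rw [SExp.size_eq, toList_ofWord, SExp.listSize_reverse, SExp.listSize]
  simp [SExp.size, Function.comp_def]
  omega

/-- The evaluation of the model checking program needs little space if there are few rows. -/
theorem bdd_programE (w : List Symbol) :
    programE.Bdd (sizeBound w.length (w.count .endRow)) [ofWord w] := by
  set n := w.length with hn
  set m := w.count .endRow with hm
  refine ⟨⟨Expr.bdd_of_isPure _ _ rfl, ?_, ?_⟩, Expr.bdd_of_isPure _ _ rfl⟩
  · refine bdd_mkE (Expr.bdd_of_isPure _ _ rfl) (Expr.bdd_of_isPure _ _ rfl)
      (Expr.bdd_of_isPure _ _ rfl) (Expr.bdd_of_isPure _ _ rfl) (Expr.bdd_of_isPure _ _ rfl) ?_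
    simp only [Expr.val, SExp.size, sizeBound, Nat.succ_mul]
    omega
  · intro p x s h
    change (ofWord w).toList = _ at h
    rw [toList_ofWord, ← List.map_reverse, List.map_eq_append_iff] at h
    obtain ⟨p', q, hpq, rfl, hq⟩ := h
    obtain ⟨a, s', rfl, rfl, rfl⟩ := List.map_eq_cons_iff.1 hq
    -- A prefix of the list of symbols is a reversed suffix of the word; the accumulator at this
    -- point is the state after reading that suffix.
    have hw : w = s'.reverse ++ a :: p'.reverse := by
      rw [← List.reverse_reverse w, hpq]
      simp
    have hrun : (p'.map fun a => SExp.leaf (some a)).foldl (fun acc x =>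
        (switchE branchE Finset.univ.toList).val [acc, x, ofWord w])
        ((mkE nilE nilE nilE nilE nilE).val [ofWord w]) =
        runWord [ofWord w] (mkState SExp.nil SExp.nil SExp.nil SExp.nil SExp.nil) p'.reverse := by
      rw [List.foldl_map, runWord, List.foldr_reverse]
      congr 1
      funext s a
      exact val_switchE (by simp) s _
    rw [hrun]
    have hlen : p'.reverse.length + 1 ≤ n := by
      rw [hn, hw]
      simp
    have hcount : (p'.reverse.count .endRow) + [a].count .endRow ≤ m := by
      rw [hm, hw, ← List.singleton_append (l := p'.reverse), List.count_append, List.count_append]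
      omega
    have hB := isBoundedState_runWord (P := tableBound n m) le_rfl [ofWord w] p'.reverse (by omega)
      (by omega)
    have hstep := hB.step (Nat.add_le_add_right (Nat.mul_le_mul (Nat.pow_le_pow_right (by omega)
      (by omega)) (by omega)) 1 : _ ≤ 2 ^ (m + 1) * (4 * n + 4) + 1) a [ofWord w]
    refine bdd_switchE _ (bdd_branchE ?_ (k := p'.reverse.length) (by omega)
      (size_le_of_isBoundedState hstep hlen))
    -- The invariant is weakened from the rows of the suffix to the rows of the whole word.
    obtain ⟨R, U, c, p, st, h, h₁, h₂, h₃⟩ := hB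
    exact ⟨R, U, c, p, st, h, h₁, h₂.trans (by omega), h₃⟩

end StackProgram

/-! ### Treewidth and complete bipartite subgraphs -/

namespace SimpleGraph

variable {V : Type*} {G : SimpleGraph V}

/-- A connected set of vertices contains a walk between any two of its vertices. -/
theorem exists_isPath_of_connected_induce {S : Set V} (hS : (G.induce S).Connected) {u v : V}
    (hu : u ∈ S) (hv : v ∈ S) : ∃ p : G.Walk u v, p.IsPath ∧ ∀ x ∈ p.support, x ∈ S := by
  obtain ⟨p, hp⟩ := hS.preconnected.exists_isPath ⟨u, hu⟩ ⟨v, hv⟩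
  refine ⟨p.map (Embedding.induce (G := G) S).toHom,
    hp.map (Embedding.induce (G := G) S).injective, fun x hx => ?_⟩
  obtain ⟨y, -, rfl⟩ := List.mem_map.1 ((Walk.support_map _ p) ▸ hx)
  exact y.2

/-- Along a shortest path, every vertex after the first is strictly closer to the target. -/
theorem exists_isPath_forall_dist_lt (hG : G.Connected) (t r : V) : ∃ q : G.Walk t r, q.IsPath ∧
    ∀ v ∈ q.support.tail, G.dist v r < G.dist t r := by
  obtain ⟨q, hq, hl⟩ := hG.exists_path_of_dist t r
  refine ⟨q, hq, ?_⟩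
  cases q with
  | nil => simp
  | cons h q =>
    intro v hv
    rw [← hl, Walk.length_cons]
    simp only [Walk.support_cons, List.tail_cons] at hv
    classical
    exact Nat.lt_succ_of_le ((dist_le (q.dropUntil v hv)).trans (q.length_dropUntil_le_length hv))

/-- In a tree, every walk from a connected set to a vertex `r` passes through any vertex of the set
which is closest to `r`. -/
theorem IsTree.mem_support_of_forall_dist_le (hG : G.IsTree) {S : Set V}
    (hS : (G.induce S).Connected) {r t z : V} (ht : t ∈ S)
    (hmin : ∀ v ∈ S, G.dist t r ≤ G.dist v r) (hz : z ∈ S) (w : G.Walk z r) : t ∈ w.support := by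
  classical
  obtain ⟨p, hp, hpS⟩ := exists_isPath_of_connected_induce hS hz ht
  obtain ⟨q, hq, hqd⟩ := exists_isPath_forall_dist_lt hG.connected t r
  -- The vertices of `q` after `t` are closer to `r` than any vertex of `S`, so `q` never returns to
  -- `p`. By uniqueness of paths in a tree, this is the path to which `w` reduces.
  have h : (p.append q).IsPath := by
    rw [Walk.isPath_def, Walk.support_append, List.nodup_append]
    refine ⟨hp.support_nodup, hq.support_nodup.tail, fun a ha b hb hab => ?_⟩
    subst hab
    exact absurd (hqd a hb) (hmin a (hpS a ha)).not_gt
  have h' : w.bypass = p.append q := congrArg Subtype.val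
    ((hG.isAcyclic.subsingleton_path z r).elim ⟨_, w.bypass_isPath⟩ ⟨_, h⟩)
  refine w.support_bypass_subset_support ?_
  rw [h']
  simp

theorem exists_forall_dist_le {S : Set V} (hS : S.Nonempty) (r : V) :
    ∃ t ∈ S, ∀ v ∈ S, G.dist t r ≤ G.dist v r := by
  obtain ⟨t, ht, h⟩ := (InvImage.wf (fun v => G.dist v r) wellFounded_lt).has_min S hS
  exact ⟨t, ht, fun v hv => not_lt.1 (h v hv)⟩

theorem nonempty_of_connected_induce {S : Set V} (hS : (G.induce S).Connected) : S.Nonempty :=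
  Set.nonempty_coe_sort.1 hS.nonempty

/-- Pairwise intersecting subtrees of a tree have a common vertex. -/
theorem IsTree.exists_forall_mem (hG : G.IsTree) {ι : Type*} {s : Finset ι} (S : ι → Set V)
    (hS : ∀ i ∈ s, (G.induce (S i)).Connected)
    (h : ∀ i ∈ s, ∀ j ∈ s, (S i ∩ S j).Nonempty) : ∃ v, ∀ i ∈ s, v ∈ S i := by
  have hne := hG.connected.nonempty
  obtain ⟨r⟩ := hne
  rcases s.eq_empty_or_nonempty with rfl | hs
  · exact ⟨r, by simp⟩
  have key : ∀ i, ∃ t, i ∈ s → t ∈ S i ∧ ∀ v ∈ S i, G.dist t r ≤ G.dist v r := by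
    intro i
    by_cases hi : i ∈ s
    · obtain ⟨t, ht, h⟩ := exists_forall_dist_le (nonempty_of_connected_induce (hS i hi)) r
      exact ⟨t, fun _ => ⟨ht, h⟩⟩
    · exact ⟨r, fun h => absurd h hi⟩
  choose t ht using key
  -- Root the tree at `r`. Among the top vertices of the subtrees, a deepest one belongs to all of
  -- them.
  obtain ⟨i, hi, hmax⟩ := s.exists_max_image (fun i => G.dist (t i) r) hs
  refine ⟨t i, fun j hj => ?_⟩
  obtain ⟨z, hzi, hzj⟩ := h i hi j hj
  obtain ⟨p, -, hpS⟩ := exists_isPath_of_connected_induce (hS j hj) hzj (ht j hj).1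
  obtain ⟨q, hq, hqd⟩ := exists_isPath_forall_dist_lt hG.connected (t j) r
  -- The walk runs inside `S j` up to its top vertex and then on to the root; it must meet `t i`.
  -- The second stretch is too close to the root for that, by maximality.
  have := hG.mem_support_of_forall_dist_le (hS i hi) (ht i hi).1 (ht i hi).2 hzi (p.append q)
  rw [Walk.support_append, List.mem_append] at this
  rcases this with h' | h'
  · exact hpS _ h'
  · exact absurd (hqd _ h') (hmax j hj).not_gt

/-- If all subtrees in one family intersect all subtrees in another family, then all subtrees in one
of the families have a common vertex. -/
theorem IsTree.exists_forall_mem_or (hG : G.IsTree) {ι : Type*} {s s' : Finset ι} (S : ι → Set V)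
    (hS : ∀ i, (G.induce (S i)).Connected) (h : ∀ i ∈ s, ∀ j ∈ s', (S i ∩ S j).Nonempty) :
    (∃ v, ∀ i ∈ s, v ∈ S i) ∨ ∃ v, ∀ j ∈ s', v ∈ S j := by
  by_cases hs : ∀ i ∈ s, ∀ j ∈ s, (S i ∩ S j).Nonempty
  · exact Or.inl (hG.exists_forall_mem S (fun i _ => hS i) hs)
  push Not at hs
  obtain ⟨i, hi, i', hi', hii'⟩ := hs
  obtain ⟨r, hr⟩ := nonempty_of_connected_induce (hS i')
  -- `t` is the gate from `S i` towards the disjoint subtree `S i'`. Every `S j` of the other family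
  -- meets both, so a walk through `S j` and then inside `S i'` to `r` passes `t`; as `t` is not in
  -- `S i'`, it lies in `S j`.
  obtain ⟨t, ht, hmin⟩ := exists_forall_dist_le (G := G) (nonempty_of_connected_induce (hS i)) r
  refine Or.inr ⟨t, fun j hj => ?_⟩
  obtain ⟨z, hz, hzj⟩ := h i hi j hj
  obtain ⟨y, hy, hyj⟩ := h i' hi' j hj
  obtain ⟨p, -, hp⟩ := exists_isPath_of_connected_induce (hS j) hzj hyj
  obtain ⟨q, -, hq⟩ := exists_isPath_of_connected_induce (hS i') hy hr
  have := hG.mem_support_of_forall_dist_le (hS i) ht hmin hz (p.append q)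
  rw [Walk.mem_support_append_iff] at this
  rcases this with h' | h'
  · exact hp _ h'
  · exact (Set.eq_empty_iff_forall_notMem.1 hii' t ⟨ht, hq _ h'⟩).elim

end SimpleGraph

namespace PDLogic

theorem TreeDecomposition.card_le_of_bag {V : Type*} {G : SimpleGraph V} (D : TreeDecomposition G)
    {A : Finset V} {b : {b // b ∈ D.bags}} (h : ∀ a ∈ A, a ∈ b.1) : A.card ≤ D.width + 1 := by
  have h₁ : A.card ≤ b.1.card := Finset.card_le_card h
  have h₂ : b.1.card ≤ D.bags.sup Finset.card := Finset.le_sup (f := Finset.card) b.2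
  rw [TreeDecomposition.width]
  omega

/-- One side of a complete bipartite subgraph has at most as many vertices as the largest bag of any
tree decomposition. -/
theorem TreeDecomposition.card_le_or {V : Type*} {G : SimpleGraph V} (D : TreeDecomposition G)
    {A B : Finset V} (h : ∀ a ∈ A, ∀ b ∈ B, G.Adj a b) :
    A.card ≤ D.width + 1 ∨ B.card ≤ D.width + 1 := by
  rcases D.isTree.exists_forall_mem_or (s := A) (s' := B) (fun v => {b | v ∈ b.1}) D.connected
    (fun u hu v hv => by
      obtain ⟨b, hb, hbu, hbv⟩ := D.edge u v (h u hu v hv)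
      exact ⟨⟨b, hb⟩, hbu, hbv⟩) with ⟨b, hb⟩ | ⟨b, hb⟩
  · exact Or.inl (D.card_le_of_bag hb)
  · exact Or.inr (D.card_le_of_bag hb)

/-- The assignment gives `x` a value, so the pair occurs in `isTrue` or in `isFalse`. -/
theorem MCInstance.adj_gaifmanGraph (I : MCInstance) (i : Fin I.team.length) {x : ℕ}
    (hx : x ∈ I.formula.vars) :
    (gaifmanGraph (mcLanguage I.team.length) I.Universe).Adj (.inr i)
      (.inl ⟨.var x, (I.formula.var_mem_subformulas_iff x).2 hx⟩) := by
  refine ⟨by simp, 2, ?_⟩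
  have key : ∀ b, I.team.get i ⟨x, hx⟩ = b → I.Assigns b (.inr i)
      (.inl ⟨.var x, (I.formula.var_mem_subformulas_iff x).2 hx⟩) := fun b hb =>
    ⟨i, _, x, hx, rfl, rfl, rfl, hb⟩
  cases h : I.team.get i ⟨x, hx⟩ with
  | true => exact ⟨MCRel.isTrue, ![_, _], key _ h, ⟨0, rfl⟩, ⟨1, rfl⟩⟩
  | false => exact ⟨MCRel.isFalse, ![_, _], key _ h, ⟨0, rfl⟩, ⟨1, rfl⟩⟩

/-- The size of the team is bounded in terms of the treewidth. -/
theorem MCInstance.length_team_le (I : MCInstance) :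
    I.team.length ≤ 2 ^ (I.formulaTeamTreewidth + 1) := by
  set G := gaifmanGraph (mcLanguage I.team.length) I.Universe with hG
  have hne : {w | ∃ D : TreeDecomposition G, D.width = w}.Nonempty := by
    obtain ⟨D⟩ := TreeDecomposition.nonempty G
    exact ⟨_, D, rfl⟩
  obtain ⟨D, hD⟩ := Nat.sInf_mem hne
  have hD : D.width = I.formulaTeamTreewidth := hD
  let f : {x // x ∈ I.formula.vars} ↪ I.Universe :=
    ⟨fun x => .inl ⟨.var x.1, (I.formula.var_mem_subformulas_iff x.1).2 x.2⟩, fun x y h => by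
      exact Subtype.ext (Formula.var.inj (congrArg Subtype.val (Sum.inl.inj h)))⟩
  -- Team elements and variables form a complete bipartite subgraph. Either there are few team
  -- elements, or there are few variables and hence few distinct assignments.
  rcases D.card_le_or (A := Finset.univ.map ⟨Sum.inr, Sum.inr_injective⟩)
    (B := Finset.univ.map f) (by
      simp only [Finset.mem_map, Finset.mem_univ, true_and, forall_exists_index,
        forall_apply_eq_imp_iff]
      exact fun i x => I.adj_gaifmanGraph i x.2) with h | h
  · rw [Finset.card_map, Finset.card_univ, Fintype.card_fin, hD] at h
    exact h.trans Nat.lt_two_pow_self.le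
  · rw [Finset.card_map, Finset.card_univ, hD] at h
    calc I.team.length ≤ Fintype.card ({x // x ∈ I.formula.vars} → Bool) := I.nodup.length_le_card
      _ = 2 ^ Fintype.card {x // x ∈ I.formula.vars} := by simp
      _ ≤ _ := Nat.pow_le_pow_right (by omega) h

end PDLogic

/-! ### The running time -/

namespace PDLogic

theorem count_endRow_encodeVar (x : ℕ) : (encodeVar x).count .endRow = 0 := by
  simp [encodeVar, List.count_eq_zero]

theorem count_endRow_encodeVarSet (X : Finset ℕ) : (encodeVarSet X).count .endRow = 0 := by
  simp [encodeVarSet, List.count_eq_zero, encodeVar]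

theorem Formula.count_endRow_encode (φ : Formula) : φ.encode.count .endRow = 0 := by
  induction φ <;>
    simp_all [Formula.encode, count_endRow_encodeVar, count_endRow_encodeVarSet]

theorem count_endRow_encodeAssignment {V : Finset ℕ} (s : {x // x ∈ V} → Bool) :
    (encodeAssignment s).count .endRow = 1 := by
  rw [encodeAssignment, List.count_append, List.count_eq_zero_of_not_mem (by simp [encodeVar])]
  rfl

/-- Turns the size bounds, which count end-of-row symbols, into bounds in the size of the team. -/
theorem MCInstance.count_endRow_encode (I : MCInstance) :
    I.encode.count .endRow = I.team.length := by
  rw [MCInstance.encode, List.count_append, Formula.count_endRow_encode,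
    List.count_cons_of_ne (by simp), List.count_flatMap]
  simp [Function.comp_def, count_endRow_encodeAssignment]

end PDLogic

namespace StackProgram

open PDLogic Turing

/-- The tables give 8 * 2 ^ m * (n + 1) ^ 2, and the remaining 6 * n + 11 is at most 12 * (n + 1) ^
2. -/
theorem sizeBound_succ_le (n m : ℕ) : sizeBound n m + 1 ≤ 20 * 2 ^ m * (n + 1) ^ 2 := by
  have h : 1 ≤ 2 ^ m := Nat.one_le_two_pow
  rw [sizeBound, tableBound, pow_succ]
  nlinarith [Nat.zero_le n, Nat.mul_le_mul_right (n ^ 2) h, Nat.mul_le_mul_right n h]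

theorem computable_two_pow : Computable fun n : ℕ => 2 ^ n :=
  (Primrec.nat_iff.2
    (Nat.Primrec.pow.comp ((Nat.Primrec.const 2).pair Nat.Primrec.id))).to_comp.of_eq
      fun n => by simp

theorem computable_pow_const {f : ℕ → ℕ} (hf : Computable f) (d : ℕ) :
    Computable fun n => f n ^ d := by
  induction d with
  | zero => simpa using Computable.const 1
  | succ d ih => exact (Primrec.nat_mul.to_comp.comp ih hf).of_eq fun n => (pow_succ _ _).symm

instance finite_alphabet (k : Stack) : Finite (Alphabet k) := by
  cases k <;> (unfold Alphabet; infer_instance)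

theorem isFPT_formulaTeamTreewidth :
    IsFPT MCInstance.encode MCInstance.Holds MCInstance.formulaTeamTreewidth := by
  classical
  obtain ⟨k, d, hkd⟩ := programE.time_le
  -- The outer power of two lists the subteams, the inner one bounds the size of the team. The 12
  -- absorbs reading the input and clearing the stacks, and exponent `d + 1` instead of `d` makes
  -- the power at least linear.
  refine ⟨machine programE.compile, fun t => (k + 12) * (20 * 2 ^ 2 ^ (t + 1)) ^ (d + 1),
    2 * (d + 1), fun s => finite_alphabet s, ?_, fun I => ?_⟩
  · exact Primrec.nat_mul.to_comp.comp (.const _) (computable_pow_const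
      (Primrec.nat_mul.to_comp.comp (.const _) (computable_two_pow.comp
        (computable_two_pow.comp .succ))) _)
  set w := I.encode with hw
  set m := I.team.length with hm
  have hb : programE.Bdd (sizeBound w.length m) [ofWord w] := by
    rw [hm, ← I.count_endRow_encode]
    exact bdd_programE w
  have hN : 4 * w.length + 8 ≤ sizeBound w.length m := Nat.le_add_right _ _
  obtain ⟨h⟩ := machine_outputs (by omega) programE w (decide I.Holds)
    (by rw [size_ofWord]; omega) hb
    ((val_programE I).trans SExp.ofBool_eq_ofProp.symm)
  have hle : programE.time (sizeBound w.length m) + w.length + sizeBound w.length m + 10 ≤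
      (k + 12) * (20 * 2 ^ 2 ^ (I.formulaTeamTreewidth + 1)) ^ (d + 1) *
        (w.length + 1) ^ (2 * (d + 1)) := by
    set N := sizeBound w.length m
    have h₁ : N + 1 ≤ 20 * 2 ^ 2 ^ (I.formulaTeamTreewidth + 1) * (w.length + 1) ^ 2 :=
      (sizeBound_succ_le _ _).trans (Nat.mul_le_mul_right _ (Nat.mul_le_mul_left _
        (Nat.pow_le_pow_right (by omega) I.length_team_le)))
    calc programE.time N + w.length + N + 10
        ≤ k * (N + 1) ^ (d + 1) + 12 * (N + 1) ^ (d + 1) := by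
          have h₂ := hkd N
          have h₃ : (N + 1) ^ d ≤ (N + 1) ^ (d + 1) := Nat.pow_le_pow_right (by omega) (by omega)
          have h₄ : N + 1 ≤ (N + 1) ^ (d + 1) := Nat.le_self_pow (by omega) _
          have h₅ := Nat.mul_le_mul_left k h₃
          omega
      _ = (k + 12) * (N + 1) ^ (d + 1) := by ring
      _ ≤ (k + 12) * (20 * 2 ^ 2 ^ (I.formulaTeamTreewidth + 1) * (w.length + 1) ^ 2) ^ (d + 1) :=
          Nat.mul_le_mul_left _ (Nat.pow_le_pow_left h₁ _)
      _ = _ := by rw [mul_pow, ← pow_mul, mul_assoc]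
  exact ⟨⟨h.toEvalsTo, h.steps_le_m.trans hle⟩⟩

end StackProgram

/-- Model checking for propositional dependence logic, parameterised by the treewidth of the
Gaifman graph of the structure encoding the formula circuit and the team, is in FPT. -/
theorem mainTheorem5 :
    PDLogic.IsFPT PDLogic.MCInstance.encode PDLogic.MCInstance.Holds
      PDLogic.MCInstance.formulaTeamTreewidth := by
  exact StackProgram.isFPT_formulaTeamTreewidth
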